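/- Let $f(x)=\dfrac{e^x}{(1+e^x)^2}$, $x\in\mathbb R$, be the density of the logistic measure $\ell$, let $N\ge 0$, and let $F(x)=\prod_{i=1}^{N+1}f(x_i)=e^{\psi(x)}$ be the density of the product measure $\ell^{N+1}$ on $\mathbb R^{N+1}$. For an open set $A\subseteq\mathbb R^{N+1}$ with $C^2$ boundary and outer unit normal $\nu$, let $\mathcal H$ be the mean curvature of $\partial A$ with respect to $\nu$, $K^2$ the sum of the squared principal curvatures, $da$ the element of area and $D_{\partial A}$ the tangential gradient. The set $A$ is called stationary (for $\ell^{N+1}$) if $N\mathcal H-\langle D\psi,\nu\rangle$ is constant on $\partial A$, and stable if it is stationary and, for every $u\in C^\infty_0(\partial A)$ with $\int_{\partial A}uF\,da=0$, $$\int_{\partial A}F\big(|D_{\partial A}u|^2-K^2u^2\big)\,da+\int_{\partial A}F\,u^2\,\langle D^2\psi\,\nu,\nu\rangle\,da\ \ge 0 .$$ For a unit vector $v\in\mathbb R^{N+1}$ and $t\in\mathbb R$ put $H^{N+1}_{v,t}=\{x\in\mathbb R^{N+1}:\langle x,v\rangle<t\}$. This half-space is called a coordinate half-space if $v$ has exactly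 one non-zero component (for instance $\{x_{N+1}<t\}$). Let $\mathcal V$ be the set of unit vectors of $\mathbb R^{N+1}$ that have exactly two non-zero components, these two having equal absolute value. Theorem. 1. A coordinate half-space $H^{N+1}_{v,t}$ is stable for $\ell^{N+1}$ if $|t|\ge 2\log(2+\sqrt3)$. 2. A non-coordinate half-space $H^{N+1}_{v,t}$ is stable for $\ell^{N+1}$ if and only if $N+1=2$, $t=0$ and $v\in\mathcal V$ (so that its boundary is a bisector line of the coordinate axes of the plane). -/

import Mathlib

open scoped InnerProductSpace ContDiff MeasureTheory

noncomputable section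

namespace HalfSpaceStability

/-- The Euclidean space of dimension `d`. -/
abbrev Euc (d : ℕ) : Type := EuclideanSpace ℝ (Fin d)

/-! ### Geometry of the boundary of an open set -/

/-- The signed distance to the boundary of `A`: negative in the interior of `A`, positive outside
the closure of `A`. -/
def sdist {d : ℕ} (A : Set (Euc d)) (x : Euc d) : ℝ :=
  Metric.infDist x A - Metric.infDist x Aᶜ

/-- `A` is an open set with `C²` boundary. For an open set this is equivalent to the signed
distance being of class `C²` near each boundary point: it is then a local defining function
(`A = {sdist A < 0}`) with gradient of norm one. -/
def IsOpenC2 {d : ℕ} (A : Set (Euc d)) : Prop :=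
  IsOpen A ∧ ∀ p ∈ frontier A, ContDiffAt ℝ 2 (sdist A) p

/-- The outer unit normal of `A` at boundary points (extended to a neighbourhood of the boundary
as the gradient of the signed distance). -/
def normal {d : ℕ} (A : Set (Euc d)) (x : Euc d) : Euc d := gradient (sdist A) x

/-- The derivative of the normal. At a boundary point it is the differential of the Gauss map on
the tangent space, and it vanishes on the normal direction. Its eigenvalues on the tangent space
are, up to a common sign, the principal curvatures. -/
def shape {d : ℕ} (A : Set (Euc d)) (x : Euc d) : Euc d →L[ℝ] Euc d := fderiv ℝ (normal A) x

/-- The sum of the principal curvatures of the boundary with respect to the normal `normal A`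
(that is, `d - 1` times the mean curvature). -/
def sumCurv {d : ℕ} (A : Set (Euc d)) (x : Euc d) : ℝ :=
  -LinearMap.trace ℝ (Euc d) (shape A x).toLinearMap

/-- The sum of the squared principal curvatures. -/
def sumSqCurv {d : ℕ} (A : Set (Euc d)) (x : Euc d) : ℝ :=
  LinearMap.trace ℝ (Euc d) ((shape A x).comp (shape A x)).toLinearMap

/-- The tangential gradient along the boundary of `A`. -/
def tanGradient {d : ℕ} (A : Set (Euc d)) (u : Euc d → ℝ) (x : Euc d) : Euc d :=
  gradient u x - ⟪gradient u x, normal A x⟫_ℝ • normal A x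

/-- The element of area of the boundary of a set in dimension `N + 1`. -/
def area {N : ℕ} (A : Set (Euc (N + 1))) : MeasureTheory.Measure (Euc (N + 1)) :=
  (μHE[N] : MeasureTheory.Measure (Euc (N + 1))).restrict (frontier A)

/-! ### Stationary and stable sets for the measure with density `f = exp ψ` -/

/-- The generalized mean curvature of the boundary of `A`, with `ψ = log f`. -/
def genMeanCurv {N : ℕ} (f : Euc (N + 1) → ℝ) (A : Set (Euc (N + 1))) (x : Euc (N + 1)) : ℝ :=
  sumCurv A x - ⟪gradient (fun y => Real.log (f y)) x, normal A x⟫_ℝ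

/-- `A` is stationary: the generalized mean curvature is constant on the boundary. -/
def IsStationary {N : ℕ} (f : Euc (N + 1) → ℝ) (A : Set (Euc (N + 1))) : Prop :=
  IsOpenC2 A ∧ ∃ c : ℝ, ∀ x ∈ frontier A, genMeanCurv f A x = c

/-- The quadratic form of the second variation, with `ψ = log f`. -/
def secondVariation {N : ℕ} (f : Euc (N + 1) → ℝ) (A : Set (Euc (N + 1)))
    (u : Euc (N + 1) → ℝ) : ℝ :=
  (∫ x, f x * (‖tanGradient A u x‖ ^ 2 - sumSqCurv A x * u x ^ 2) ∂(area A)) +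
    ∫ x, f x * u x ^ 2 *
      ⟪fderiv ℝ (gradient (fun y => Real.log (f y))) x (normal A x), normal A x⟫_ℝ ∂(area A)

/-- `A` is stable: it is stationary and the second variation is nonnegative on the smooth compactly
supported functions on the boundary with mean zero. Such functions are given as restrictions to
the boundary of smooth compactly supported functions on the whole space. -/
def IsStable {N : ℕ} (f : Euc (N + 1) → ℝ) (A : Set (Euc (N + 1))) : Prop :=
  IsStationary f A ∧
    ∀ u : Euc (N + 1) → ℝ, ContDiff ℝ ∞ u → HasCompactSupport u →
      ∫ x, u x * f x ∂(area A) = 0 → 0 ≤ secondVariation f A u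

/-! ### The logistic measure and half-spaces -/

/-- The density of the logistic measure on the line. -/
def logisticDensity (x : ℝ) : ℝ := Real.exp x / (1 + Real.exp x) ^ 2

/-- The density of the `d`-fold product of the logistic measure. -/
def logisticProdDensity (d : ℕ) (x : Euc d) : ℝ := ∏ i, logisticDensity (x i)

/-- The half-space `{x : ⟨x, v⟩ < t}`. -/
def halfSpace {d : ℕ} (v : Euc d) (t : ℝ) : Set (Euc d) := {x | ⟪x, v⟫_ℝ < t}

/-- For a unit vector `v`: exactly one component is non-null, that is, half-spaces with normal `v`
are coordinate half-spaces. -/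
def IsCoordinate {d : ℕ} (v : Euc d) : Prop := ∃ i, ∀ k, k ≠ i → v k = 0

/-- The unit vectors with exactly two non-null components, equal in absolute value. -/
def bisectorVectors (d : ℕ) : Set (Euc d) :=
  {v | ‖v‖ = 1 ∧ ∃ i j, i ≠ j ∧ (∀ k, k ≠ i → k ≠ j → v k = 0) ∧ |v i| = |v j| ∧ |v i| ≠ 0}

end HalfSpaceStability

end

noncomputable section

namespace HalfSpaceStability

open MeasureTheory Filter Topology Set

/-! A half-space is flat with constant normal `v`, so both curvature terms drop out. With `s =
slope`, which is tanh(x/2), the logistic density satisfies f = (1 - s²)/4, s' = 2f, (log f)' = -s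
and (log f)'' = -2f. Stationarity therefore says that ∑ v_i s(x_i) is constant on the hyperplane,
and the second variation is ∫ F |∇w|² - 2 ∫ F w² ∑ v_i² f(x_i), where w is the test function read in
an isometric chart of the hyperplane.

Coordinate case: the potential is the constant f(t) and F is f(t) times the product density in the
remaining variables. Stability follows from a Poincaré inequality with spectral gap at least 2 f(t).
The logistic measure satisfies Poincaré with constant 4 (`poincare_logistic`), this constant passes
unchanged to products by Efron–Stein (`poincare_pi_logisticMeasure`), and the assumption on t gives
f(t) ≤ 1/8.

Non-coordinate case: differentiating the stationarity equation along v_j e_i - v_i e_j gives |x_i| =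
|x_j| on the whole hyperplane whenever v_i and v_j are nonzero (`abs_eq_of_stationary`). Suitable
points then force t = 0 and v to be a bisector vector.

For a bisector, the hyperplane carries the weight f² (up to scaling) in one variable and f in each
of the others, while the potential is f of the first variable. In the plane only that variable
remains, and stability becomes 4 ∫ f³u² ≤ ∫ f²u'² under ∫ f²u = 0 (`bisector_inequality`). In higher
dimension an odd function g of one further variable has mean zero, and its second variation is a
positive multiple of (1/6) ∫ f g'² - (1/15) ∫ f g². This is negative for g = s + s³, and truncation
makes g admissible (`not_isStable_of_isBisectorAt`).

Both inequalities on the line come from Hardy inequalities for functions vanishing at 0. These are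
proved by completing the square with a solution of a Riccati equation. -/

/-! ### The logistic density on the line -/

/-- The logarithmic derivative of the logistic density, up to sign. -/
def slope (x : ℝ) : ℝ := 2 * Real.sigmoid x - 1

lemma logisticDensity_eq_sigmoid (x : ℝ) :
    logisticDensity x = Real.sigmoid x * (1 - Real.sigmoid x) := by
  unfold logisticDensity
  rw [Real.sigmoid_def, Real.exp_neg]
  have := Real.exp_pos x
  field_simp
  ring

lemma logisticDensity_eq_slope (x : ℝ) : logisticDensity x = (1 - slope x ^ 2) / 4 := by
  rw [logisticDensity_eq_sigmoid, slope]; ring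

lemma logisticDensity_pos (x : ℝ) : 0 < logisticDensity x := by
  unfold logisticDensity; positivity

lemma logisticDensity_le (x : ℝ) : logisticDensity x ≤ 1 / 4 := by
  rw [logisticDensity_eq_slope]; nlinarith [sq_nonneg (slope x)]

lemma abs_slope_le (x : ℝ) : |slope x| ≤ 1 := by
  rw [slope, abs_le]
  constructor <;> linarith [Real.sigmoid_nonneg x, Real.sigmoid_le_one x]

lemma slope_neg (x : ℝ) : slope (-x) = -slope x := by
  rw [slope, slope, Real.sigmoid_neg]; ring

lemma slope_zero : slope 0 = 0 := by simp [slope]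

lemma slope_strictMono : StrictMono slope := fun a b h => by
  have := Real.sigmoid_lt h
  simp only [slope]; linarith

lemma slope_pos {x : ℝ} (hx : 0 < x) : 0 < slope x := slope_zero ▸ slope_strictMono hx

lemma logisticDensity_neg (x : ℝ) : logisticDensity (-x) = logisticDensity x := by
  simp [logisticDensity_eq_slope, slope_neg]

lemma hasDerivAt_slope (x : ℝ) : HasDerivAt slope (2 * logisticDensity x) x := by
  have h := ((Real.hasDerivAt_sigmoid x).const_mul 2).sub_const 1
  rw [logisticDensity_eq_sigmoid]
  exact h

lemma hasDerivAt_logisticDensity (x : ℝ) :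
    HasDerivAt logisticDensity (-(slope x * logisticDensity x)) x := by
  have h := (((hasDerivAt_slope x).fun_pow 2).const_sub 1).div_const 4
  rw [← funext logisticDensity_eq_slope] at h
  refine h.congr_deriv ?_
  push_cast
  ring

lemma continuous_logisticDensity : Continuous logisticDensity :=
  continuous_iff_continuousAt.2 fun x => (hasDerivAt_logisticDensity x).continuousAt

lemma contDiff_slope {n : ℕ∞} : ContDiff ℝ n slope := by
  have : ContDiff ℝ n Real.sigmoid := contDiff_sigmoid.of_le (by simp)
  exact (contDiff_const.mul this).sub contDiff_const

lemma hasDerivAt_log_logisticDensity (x : ℝ) :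
    HasDerivAt (fun y => Real.log (logisticDensity y)) (-slope x) x := by
  convert (hasDerivAt_logisticDensity x).log (logisticDensity_pos x).ne' using 1
  have := (logisticDensity_pos x).ne'
  field_simp

/-- The logistic distribution function transports the logistic measure to the unit interval. -/
lemma integral_logisticDensity_mul_comp_sigmoid (G : ℝ → ℝ) :
    ∫ x, logisticDensity x * G (Real.sigmoid x) = ∫ y in (0 : ℝ)..1, G y := by
  have h := integral_image_eq_integral_abs_deriv_smul (s := univ) MeasurableSet.univ
    (fun x _ => (Real.hasDerivAt_sigmoid x).hasDerivWithinAt) Real.sigmoid_injective.injOn G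
  rw [image_univ, Real.range_sigmoid, setIntegral_univ] at h
  rw [intervalIntegral.integral_of_le zero_le_one, integral_Ioc_eq_integral_Ioo, h]
  refine integral_congr_ae (ae_of_all _ fun x => ?_)
  simp only [← logisticDensity_eq_sigmoid, abs_of_pos (logisticDensity_pos x), smul_eq_mul]

lemma integrable_logisticDensity : Integrable logisticDensity := by
  have h := integrableOn_image_iff_integrableOn_abs_deriv_smul (s := univ) MeasurableSet.univ
    (fun x _ => (Real.hasDerivAt_sigmoid x).hasDerivWithinAt) Real.sigmoid_injective.injOn
    (fun _ => (1 : ℝ))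
  rw [image_univ, Real.range_sigmoid, integrableOn_univ] at h
  refine (h.1 (by simp)).congr (ae_of_all _ fun x => ?_)
  simp only [← logisticDensity_eq_sigmoid, abs_of_pos (logisticDensity_pos x), smul_eq_mul,
    mul_one]

lemma integral_logisticDensity : ∫ x, logisticDensity x = 1 := by
  simpa using integral_logisticDensity_mul_comp_sigmoid fun _ => 1

lemma integral_logisticDensity_sq : ∫ x, logisticDensity x ^ 2 = 1 / 6 := by
  have h := integral_logisticDensity_mul_comp_sigmoid fun y => y - y ^ 2
  rw [intervalIntegral.integral_sub (by simp) (by simp), integral_id, integral_pow] at h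
  rw [show (1 / 6 : ℝ) = (1 ^ 2 - 0 ^ 2) / 2 - (1 ^ (2 + 1) - 0 ^ (2 + 1)) / ((2 : ℕ) + 1) by
    norm_num, ← h]
  congr 1; ext x; rw [logisticDensity_eq_sigmoid]; ring

lemma integral_logisticDensity_cube : ∫ x, logisticDensity x ^ 3 = 1 / 30 := by
  have h := integral_logisticDensity_mul_comp_sigmoid fun y => y ^ 2 - 2 * y ^ 3 + y ^ 4
  have h2 : ∫ y in (0 : ℝ)..1, (y ^ 2 - 2 * y ^ 3 + y ^ 4) = 1 / 30 := by
    rw [intervalIntegral.integral_add (Continuous.intervalIntegrable (by fun_prop) _ _)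
      (Continuous.intervalIntegrable (by fun_prop) _ _),
      intervalIntegral.integral_sub (Continuous.intervalIntegrable (by fun_prop) _ _)
      (Continuous.intervalIntegrable (by fun_prop) _ _), intervalIntegral.integral_const_mul]
    simp only [integral_pow]
    norm_num
  rw [← h2, ← h]
  congr 1; ext x; rw [logisticDensity_eq_sigmoid]; ring

lemma integrable_logisticDensity_mul {G : ℝ → ℝ} (hG : Continuous G) {C : ℝ}
    (hC : ∀ x, |G x| ≤ C) : Integrable fun x => logisticDensity x * G x := by
  refine (integrable_logisticDensity.bdd_mul (c := C) hG.aestronglyMeasurable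
    (ae_of_all _ fun x => by simpa using hC x)).congr (ae_of_all _ fun x => mul_comm _ _)

lemma abs_logisticDensity_le (x : ℝ) : |logisticDensity x| ≤ 1 / 4 := by
  rw [abs_of_pos (logisticDensity_pos x)]; exact logisticDensity_le x

lemma integrable_logisticDensity_sq : Integrable fun x => logisticDensity x ^ 2 :=
  (integrable_logisticDensity_mul continuous_logisticDensity abs_logisticDensity_le).congr
    (ae_of_all _ fun _ => (sq _).symm)

lemma integrable_logisticDensity_cube : Integrable fun x => logisticDensity x ^ 3 := by
  refine (integrable_logisticDensity_mul (G := fun x => logisticDensity x ^ 2)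
    (continuous_logisticDensity.pow 2) (C := 1) fun x => ?_).congr (ae_of_all _ fun _ => by ring)
  rw [abs_pow]
  exact pow_le_one₀ (abs_nonneg _) ((abs_logisticDensity_le x).trans (by norm_num))

/-! ### Hardy inequalities -/

/-- A Hardy inequality on a half-line for functions vanishing at the origin, derived from a
solution `g / slope` of a Riccati inequality. -/
lemma hardy_interval {p V g g' w w' : ℝ → ℝ} (hp : Continuous p) (hp0 : ∀ x, 0 < p x)
    (hV : Continuous V) (hg : ∀ x, HasDerivAt g (g' x) x) (hg0 : ∀ x, 0 ≤ g x)
    (hric : ∀ x, 0 < x →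
      (g' x * slope x - g x * (2 * logisticDensity x)) / slope x ^ 2 + (g x / slope x) ^ 2 / p x
        ≤ -V x)
    (hw : ∀ x, HasDerivAt w (w' x) x) (hw' : Continuous w') (hw0 : w 0 = 0) {b : ℝ} (hb : 0 ≤ b) :
    ∫ x in (0 : ℝ)..b, V x * w x ^ 2 ≤ ∫ x in (0 : ℝ)..b, p x * w' x ^ 2 := by
  have hwc : Continuous w := continuous_iff_continuousAt.2 fun x => (hw x).continuousAt
  have hgc : Continuous g := continuous_iff_continuousAt.2 fun x => (hg x).continuousAt
  set Φ : ℝ → ℝ := fun x => g x / slope x * w x ^ 2 with hΦ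
  have hderiv : ∀ x, 0 < x → HasDerivAt Φ
      ((g' x * slope x - g x * (2 * logisticDensity x)) / slope x ^ 2 * w x ^ 2 +
        g x / slope x * (2 * w x * w' x)) x := fun x hx => by
    refine (((hg x).fun_div (hasDerivAt_slope x) (slope_pos hx).ne').fun_mul
      ((hw x).fun_pow 2)).congr_deriv ?_
    push_cast
    ring
  -- `g / slope` may have a simple pole at 0, but `w` vanishes there. Hence `w / slope` has a finite
  -- limit and the remaining factor `w` sends Φ to 0.
  have hcont0 : ContinuousAt Φ 0 := by
    have h1 : Tendsto (fun x => x⁻¹ * w x) (𝓝[≠] 0) (𝓝 (w' 0)) := by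
      simpa [hw0] using hasDerivAt_iff_tendsto_slope_zero.1 (hw 0)
    have h2 : Tendsto (fun x => x⁻¹ * slope x) (𝓝[≠] 0) (𝓝 (2 * logisticDensity 0)) := by
      simpa [slope_zero] using hasDerivAt_iff_tendsto_slope_zero.1 (hasDerivAt_slope 0)
    have h3 := ((h1.div h2 (by have := logisticDensity_pos 0; positivity)).mul
      (hwc.tendsto' 0 0 hw0 |>.mono_left nhdsWithin_le_nhds)).mul
      (hgc.continuousAt (x := 0)).continuousWithinAt.tendsto
    rw [continuousAt_iff_punctured_nhds]
    have h0 : Φ 0 = 0 := by simp [hΦ, hw0]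
    rw [h0]
    refine (h3.congr' ?_).trans (by simp)
    filter_upwards [self_mem_nhdsWithin] with x hx
    have hx : x ≠ 0 := hx
    have hs : slope x ≠ 0 := fun h => hx (slope_strictMono.injective (h.trans slope_zero.symm))
    simp only [hΦ, Pi.div_apply]
    field_simp
  have hcont : ContinuousOn Φ (Icc 0 b) := fun x hx => by
    rcases hx.1.eq_or_lt with rfl | h
    · exact hcont0.continuousWithinAt
    · exact (hderiv x h).continuousAt.continuousWithinAt
  have hφ : Continuous fun x => p x * w' x ^ 2 - V x * w x ^ 2 := by fun_prop
  -- The pointwise bound Φ' ≤ p w'² - V w² is integrated. Only the signs Φ(0) = 0 and Φ(b) ≥ 0 of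
  -- the boundary terms matter.
  have key := intervalIntegral.sub_le_integral_of_hasDeriv_right_of_le hb hcont
    (fun x hx => (hderiv x hx.1).hasDerivWithinAt) (φ := fun x => p x * w' x ^ 2 - V x * w x ^ 2)
    hφ.continuousOn.integrableOn_Icc (fun x hx => ?_)
  · have hΦ0 : Φ 0 = 0 := by simp [hΦ, hw0]
    have hΦb : 0 ≤ Φ b := by
      rcases hb.eq_or_lt with rfl | h
      · exact hΦ0.ge
      · exact mul_nonneg (div_nonneg (hg0 b) (slope_pos h).le) (sq_nonneg _)
    rw [intervalIntegral.integral_sub (Continuous.intervalIntegrable (by fun_prop) _ _)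
      (Continuous.intervalIntegrable (by fun_prop) _ _)] at key
    linarith
  · have h1 := mul_le_mul_of_nonneg_right (hric x hx.1) (sq_nonneg (w x))
    -- Completing the square produces h²/p · w² with h = g / slope. This is exactly the term that
    -- the Riccati inequality trades for -V - h'.
    have h2 : 0 ≤ p x * (w' x - g x / slope x / p x * w x) ^ 2 :=
      mul_nonneg (hp0 x).le (sq_nonneg _)
    have h3 : p x * (w' x - g x / slope x / p x * w x) ^ 2 = p x * w' x ^ 2
        - g x / slope x * (2 * w x * w' x) + (g x / slope x) ^ 2 / p x * w x ^ 2 := by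
      have := (hp0 x).ne'
      field_simp
      ring
    linarith

/-- The Hardy inequality on the whole line for even weights. -/
lemma hardy_line {p V g g' w w' : ℝ → ℝ} (hp : Continuous p) (hp0 : ∀ x, 0 < p x)
    (hV : Continuous V) (hpe : ∀ x, p (-x) = p x) (hVe : ∀ x, V (-x) = V x)
    (hg : ∀ x, HasDerivAt g (g' x) x) (hg0 : ∀ x, 0 ≤ g x)
    (hric : ∀ x, 0 < x →
      (g' x * slope x - g x * (2 * logisticDensity x)) / slope x ^ 2 + (g x / slope x) ^ 2 / p x
        ≤ -V x)
    (hw : ∀ x, HasDerivAt w (w' x) x) (hw' : Continuous w') (hw0 : w 0 = 0)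
    (hi1 : Integrable fun x => V x * w x ^ 2) (hi2 : Integrable fun x => p x * w' x ^ 2) :
    ∫ x, V x * w x ^ 2 ≤ ∫ x, p x * w' x ^ 2 := by
  have hwc : Continuous w := continuous_iff_continuousAt.2 fun x => (hw x).continuousAt
  refine le_of_tendsto_of_tendsto
    (intervalIntegral_tendsto_integral hi1 tendsto_neg_atTop_atBot tendsto_id)
    (intervalIntegral_tendsto_integral hi2 tendsto_neg_atTop_atBot tendsto_id) ?_
  filter_upwards [eventually_ge_atTop 0] with b hb
  have h1 := hardy_interval hp hp0 hV hg hg0 hric hw hw' hw0 hb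
  have h2 := hardy_interval hp hp0 hV hg hg0 hric (w := fun x => w (-x)) (w' := fun x => -w' (-x))
    (fun x => by
      simpa [Function.comp_def] using (hw (-x)).comp x (hasDerivAt_neg x)) (by fun_prop) (by simpa) hb
  have e1 : ∫ x in (0 : ℝ)..b, V x * w (-x) ^ 2 = ∫ x in (-b)..0, V x * w x ^ 2 := by
    have := intervalIntegral.integral_comp_neg (a := 0) (b := b) (fun x => V x * w x ^ 2)
    simpa [hVe] using this
  have e2 : ∫ x in (0 : ℝ)..b, p x * (-w' (-x)) ^ 2 = ∫ x in (-b)..0, p x * w' x ^ 2 := by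
    have := intervalIntegral.integral_comp_neg (a := 0) (b := b) (fun x => p x * w' x ^ 2)
    simpa [hpe] using this
  simp only [id]
  rw [← intervalIntegral.integral_add_adjacent_intervals (a := -b) (b := 0) (c := b)
      (hi1.intervalIntegrable) hi1.intervalIntegrable,
    ← intervalIntegral.integral_add_adjacent_intervals (a := -b) (b := 0) (c := b)
      (hi2.intervalIntegrable) hi2.intervalIntegrable]
  linarith

/-- The function φ = sinh(x/2) vanishes at 0 and solves (f φ')' = -f φ / 4. Its Riccati variable f
φ'/φ is f / (2 slope), whence the choice g = f/2, for which the Riccati inequality is an equality.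
-/
lemma hardy_logistic {w w' : ℝ → ℝ} (hw : ∀ x, HasDerivAt w (w' x) x) (hw' : Continuous w')
    (hw0 : w 0 = 0) (hi1 : Integrable fun x => logisticDensity x * w x ^ 2)
    (hi2 : Integrable fun x => logisticDensity x * w' x ^ 2) :
    ∫ x, logisticDensity x * w x ^ 2 ≤ 4 * ∫ x, logisticDensity x * w' x ^ 2 := by
  have hc := continuous_logisticDensity
  have e : (fun x => logisticDensity x / 4 * w x ^ 2) =
      fun x => 1 / 4 * (logisticDensity x * w x ^ 2) := by ext; ring
  have h := hardy_line hc logisticDensity_pos (V := fun x => logisticDensity x / 4) (by fun_prop)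
    logisticDensity_neg (fun x => by rw [logisticDensity_neg])
    (g := fun x => logisticDensity x / 2) (fun x => (hasDerivAt_logisticDensity x).div_const 2)
    (fun x => by have := logisticDensity_pos x; positivity) (fun x hx => ?_) hw hw' hw0
    (e ▸ hi1.const_mul _) hi2
  · rw [e, integral_const_mul] at h
    linarith
  · have h1 := (slope_pos hx).ne'
    have h2 := (logisticDensity_pos x).ne'
    apply le_of_eq
    field_simp
    rw [logisticDensity_eq_slope]
    ring

/-- Here `slope` itself is the odd solution: f² slope' = 2f³ has derivative -6 f³ slope. The Riccati
variable is 2f³ / slope, so g = 2f³, again with equality. -/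
lemma hardy_logistic_sq {w w' : ℝ → ℝ} (hw : ∀ x, HasDerivAt w (w' x) x) (hw' : Continuous w')
    (hw0 : w 0 = 0) (hi1 : Integrable fun x => logisticDensity x ^ 3 * w x ^ 2)
    (hi2 : Integrable fun x => logisticDensity x ^ 2 * w' x ^ 2) :
    6 * ∫ x, logisticDensity x ^ 3 * w x ^ 2 ≤ ∫ x, logisticDensity x ^ 2 * w' x ^ 2 := by
  have hc := continuous_logisticDensity
  have e : (fun x => 6 * logisticDensity x ^ 3 * w x ^ 2) =
      fun x => 6 * (logisticDensity x ^ 3 * w x ^ 2) := by ext; ring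
  have h := hardy_line (hc.pow 2) (fun x => pow_pos (logisticDensity_pos x) 2)
    (V := fun x => 6 * logisticDensity x ^ 3) (by fun_prop)
    (fun x => by simp only [Pi.pow_apply, logisticDensity_neg])
    (fun x => by simp only [logisticDensity_neg])
    (g := fun x => 2 * logisticDensity x ^ 3)
    (fun x => ((hasDerivAt_logisticDensity x).pow 3).const_mul 2)
    (fun x => by have := logisticDensity_pos x; positivity) (fun x hx => ?_) hw hw' hw0
    (e ▸ hi1.const_mul _) hi2
  · rw [e, integral_const_mul] at h
    exact h
  · have h1 := (slope_pos hx).ne'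
    have h2 := (logisticDensity_pos x).ne'
    apply le_of_eq
    simp only [Pi.pow_apply]
    push_cast
    field_simp
    ring

/-! ### Spectral inequalities on the line for compactly supported functions -/

lemma integrable_mul_of_hasCompactSupport {p u : ℝ → ℝ} (hp : Continuous p) (hu : Continuous u)
    (hs : HasCompactSupport u) : Integrable fun x => p x * u x :=
  (hp.mul hu).integrable_of_hasCompactSupport (hs.mono fun x hx => by
    contrapose! hx; simp_all)

lemma integrable_mul_sq_of_hasCompactSupport {p u : ℝ → ℝ} (hp : Continuous p) (hu : Continuous u)
    (hs : HasCompactSupport u) : Integrable fun x => p x * u x ^ 2 :=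
  integrable_mul_of_hasCompactSupport hp (hu.pow 2) (hs.mono fun x hx => by
    contrapose! hx; simp_all)

/-- The Poincaré inequality for the logistic measure on the line. -/
lemma poincare_logistic {u u' : ℝ → ℝ} (hu : ∀ x, HasDerivAt u (u' x) x) (hu' : Continuous u')
    (hs : HasCompactSupport u) (hs' : HasCompactSupport u') :
    (∫ x, logisticDensity x * u x ^ 2) - (∫ x, logisticDensity x * u x) ^ 2 ≤
      4 * ∫ x, logisticDensity x * u' x ^ 2 := by
  have hc := continuous_logisticDensity
  have huc : Continuous u := continuous_iff_continuousAt.2 fun x => (hu x).continuousAt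
  have i1 : Integrable fun x => logisticDensity x * u x :=
    integrable_mul_of_hasCompactSupport hc huc hs
  have i2 : Integrable fun x => logisticDensity x * u x ^ 2 :=
    integrable_mul_sq_of_hasCompactSupport hc huc hs
  have i3 : Integrable fun x => logisticDensity x * u' x ^ 2 :=
    integrable_mul_sq_of_hasCompactSupport hc hu' hs'
  set c := u 0
  have e : (fun x => logisticDensity x * (u x - c) ^ 2) = fun x => logisticDensity x * u x ^ 2 +
      -2 * c * (logisticDensity x * u x) + c ^ 2 * logisticDensity x := by ext; ring
  have i4 := integrable_logisticDensity.const_mul (c ^ 2)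
  have h := hardy_logistic (w := fun x => u x - c) (fun x => (hu x).sub_const c) hu' (sub_self c)
    (e ▸ (i2.fun_add (i1.const_mul _)).add i4) i3
  rw [e, integral_add (i2.fun_add (i1.const_mul _)) i4, integral_add i2 (i1.const_mul _),
    integral_const_mul, integral_const_mul, integral_logisticDensity] at h
  -- The mean minimizes the quadratic deviation, so the variance is at most the deviation from u(0),
  -- to which the Hardy inequality applies.
  nlinarith [sq_nonneg ((∫ x, logisticDensity x * u x) - c)]

/-- The stability inequality along a bisector line. -/
lemma bisector_inequality {u u' : ℝ → ℝ} (hu : ∀ x, HasDerivAt u (u' x) x) (hu' : Continuous u')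
    (hs : HasCompactSupport u) (hs' : HasCompactSupport u')
    (h0 : ∫ x, logisticDensity x ^ 2 * u x = 0) :
    4 * ∫ x, logisticDensity x ^ 3 * u x ^ 2 ≤ ∫ x, logisticDensity x ^ 2 * u' x ^ 2 := by
  have hc := continuous_logisticDensity
  have huc : Continuous u := continuous_iff_continuousAt.2 fun x => (hu x).continuousAt
  have i1 : Integrable fun x => logisticDensity x ^ 2 * u x :=
    integrable_mul_of_hasCompactSupport (hc.pow 2) huc hs
  have i2 : Integrable fun x => logisticDensity x ^ 3 * u x :=
    integrable_mul_of_hasCompactSupport (hc.pow 3) huc hs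
  have i3 : Integrable fun x => logisticDensity x ^ 3 * u x ^ 2 :=
    integrable_mul_sq_of_hasCompactSupport (hc.pow 3) huc hs
  have i4 : Integrable fun x => logisticDensity x ^ 2 * u' x ^ 2 :=
    integrable_mul_sq_of_hasCompactSupport (hc.pow 2) hu' hs'
  set c := u 0
  have e : (fun x => logisticDensity x ^ 3 * (u x - c) ^ 2) =
      fun x => logisticDensity x ^ 3 * u x ^ 2 +
      -2 * c * (logisticDensity x ^ 3 * u x) + c ^ 2 * logisticDensity x ^ 3 := by ext; ring
  have j3 := integrable_logisticDensity_cube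
  have h := hardy_logistic_sq (w := fun x => u x - c) (fun x => (hu x).sub_const c) hu'
    (sub_self c) (e ▸ (i3.fun_add (i2.const_mul _)).add (j3.const_mul _)) i4
  rw [e, integral_add (i3.fun_add (i2.const_mul _)) (j3.const_mul _),
    integral_add i3 (i2.const_mul _),
    integral_const_mul, integral_const_mul, integral_logisticDensity_cube] at h
  -- Hardy applied to u - c leaves the cross term -12c ∫ f³u, while the constraint concerns the
  -- weight f². The square is chosen so that it contains this cross term and 2 ∫ f³u², plus a
  -- multiple of ∫ f²u = 0. Its constant part integrates to c²(1/2 - 1 + 3/5) = c²/10, below the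
  -- c²/5 supplied by Hardy, so the constant drops from 6 to 4.
  have hsq : 0 ≤ ∫ x, 2 * logisticDensity x *
      (logisticDensity x * u x + c * (1 - 6 * logisticDensity x) / 2) ^ 2 :=
    integral_nonneg fun x => mul_nonneg (by have := logisticDensity_pos x; positivity)
      (sq_nonneg _)
  have e2 : (fun x => 2 * logisticDensity x *
      (logisticDensity x * u x + c * (1 - 6 * logisticDensity x) / 2) ^ 2) = fun x =>
      2 * (logisticDensity x ^ 3 * u x ^ 2) + 2 * c * (logisticDensity x ^ 2 * u x) +
      -12 * c * (logisticDensity x ^ 3 * u x) + c ^ 2 / 2 * logisticDensity x +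
      -6 * c ^ 2 * logisticDensity x ^ 2 + 18 * c ^ 2 * logisticDensity x ^ 3 := by ext; ring
  have a1 := (i3.const_mul 2).fun_add (i1.const_mul (2 * c))
  have a2 := a1.fun_add (i2.const_mul (-12 * c))
  have a3 := a2.fun_add (integrable_logisticDensity.const_mul (c ^ 2 / 2))
  have a4 := a3.fun_add (integrable_logisticDensity_sq.const_mul (-6 * c ^ 2))
  rw [e2, integral_add a4 (j3.const_mul _),
    integral_add a3 (integrable_logisticDensity_sq.const_mul _),
    integral_add a2 (integrable_logisticDensity.const_mul _), integral_add a1 (i2.const_mul _),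
    integral_add (i3.const_mul _) (i1.const_mul _)] at hsq
  simp only [integral_const_mul, h0, integral_logisticDensity, integral_logisticDensity_sq,
    integral_logisticDensity_cube] at hsq
  nlinarith [sq_nonneg c]


/-! ### The Poincaré inequality for products of the logistic measure -/

/-- The logistic measure on the line. -/
def logisticMeasure : Measure ℝ := volume.withDensity fun x => ENNReal.ofReal (logisticDensity x)

lemma measurable_logisticDensity : Measurable logisticDensity :=
  continuous_logisticDensity.measurable

instance : IsProbabilityMeasure logisticMeasure := ⟨by
  rw [logisticMeasure, withDensity_apply _ MeasurableSet.univ, Measure.restrict_univ,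
    ← ofReal_integral_eq_lintegral_ofReal integrable_logisticDensity
      (ae_of_all _ fun x => (logisticDensity_pos x).le), integral_logisticDensity]
  simp⟩

lemma integral_logisticMeasure (G : ℝ → ℝ) :
    ∫ x, G x ∂logisticMeasure = ∫ x, logisticDensity x * G x := by
  rw [logisticMeasure, integral_withDensity_eq_integral_toReal_smul
    measurable_logisticDensity.ennreal_ofReal (ae_of_all _ fun x => ENNReal.ofReal_lt_top)]
  refine integral_congr_ae (ae_of_all _ fun x => ?_)
  simp [ENNReal.toReal_ofReal (logisticDensity_pos x).le]

/-- A product measure is determined by its values on boxes, where the indicator times the product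
density factors and Fubini applies. -/
lemma pi_logisticMeasure_eq_withDensity (n : ℕ) :
    Measure.pi (fun _ : Fin n => logisticMeasure) =
      volume.withDensity fun x => ENNReal.ofReal (∏ i, logisticDensity (x i)) := by
  refine Measure.pi_eq fun s hs => ?_
  have hint : Integrable fun x : Fin n → ℝ => ∏ i, logisticDensity (x i) :=
    Integrable.fintype_prod fun _ => integrable_logisticDensity
  rw [withDensity_apply _ (MeasurableSet.univ_pi hs),
    ← ofReal_integral_eq_lintegral_ofReal hint.integrableOn
      (ae_of_all _ fun x => Finset.prod_nonneg fun i _ => (logisticDensity_pos _).le),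
    ← integral_indicator (MeasurableSet.univ_pi hs)]
  have h1 : (univ.pi s).indicator (fun x : Fin n → ℝ => ∏ i, logisticDensity (x i)) =
      fun x => ∏ i, (s i).indicator logisticDensity (x i) := by
    ext x
    by_cases hx : x ∈ univ.pi s
    · rw [indicator_of_mem hx]
      exact Finset.prod_congr rfl fun i _ => (indicator_of_mem (hx i (mem_univ i)) _).symm
    · rw [indicator_of_notMem hx]
      simp only [Set.mem_pi, mem_univ, forall_const, not_forall] at hx
      obtain ⟨i, hi⟩ := hx
      exact (Finset.prod_eq_zero (Finset.mem_univ i) (indicator_of_notMem hi _)).symm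
  rw [h1, integral_fintype_prod_volume_eq_prod (f := fun i => (s i).indicator logisticDensity),
    ENNReal.ofReal_prod_of_nonneg fun i _ =>
      integral_nonneg fun x => indicator_nonneg (fun y _ => (logisticDensity_pos y).le) x]
  refine Finset.prod_congr rfl fun i _ => ?_
  rw [integral_indicator (hs i), logisticMeasure, withDensity_apply _ (hs i),
    ofReal_integral_eq_lintegral_ofReal integrable_logisticDensity.integrableOn
      (ae_of_all _ fun x => (logisticDensity_pos x).le)]

lemma integral_pi_logisticMeasure (n : ℕ) (G : (Fin n → ℝ) → ℝ) :
    ∫ x, G x ∂(Measure.pi fun _ : Fin n => logisticMeasure) =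
      ∫ x, (∏ i, logisticDensity (x i)) * G x := by
  have hm : Measurable fun x : Fin n → ℝ => ∏ i, logisticDensity (x i) :=
    Finset.measurable_prod _ fun i _ => measurable_logisticDensity.comp (measurable_pi_apply i)
  rw [pi_logisticMeasure_eq_withDensity, integral_withDensity_eq_integral_toReal_smul
    hm.ennreal_ofReal (ae_of_all _ fun x => ENNReal.ofReal_lt_top)]
  refine integral_congr_ae (ae_of_all _ fun x => ?_)
  simp [ENNReal.toReal_ofReal (Finset.prod_nonneg fun i _ => (logisticDensity_pos (x i)).le)]

lemma integrable_of_abs_le {Z : Type*} [MeasurableSpace Z] {ρ : Measure Z} [IsFiniteMeasure ρ]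
    {g : Z → ℝ} (hg : StronglyMeasurable g) {D : ℝ} (hD : ∀ z, |g z| ≤ D) : Integrable g ρ :=
  Integrable.of_bound hg.aestronglyMeasurable D (ae_of_all _ hD)

lemma abs_integral_le_of_abs_le {Z : Type*} [MeasurableSpace Z] {ρ : Measure Z}
    [IsProbabilityMeasure ρ] {g : Z → ℝ} {D : ℝ} (hD : ∀ z, |g z| ≤ D) :
    |∫ z, g z ∂ρ| ≤ D := by
  simpa using norm_integral_le_of_norm_le_const (μ := ρ) (f := g) (C := D) (ae_of_all _ hD)

lemma sq_integral_le_integral_sq {Z : Type*} [MeasurableSpace Z] {ρ : Measure Z}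
    [IsProbabilityMeasure ρ] {g : Z → ℝ} (hg : Integrable g ρ)
    (hg2 : Integrable (fun z => g z ^ 2) ρ) : (∫ z, g z ∂ρ) ^ 2 ≤ ∫ z, g z ^ 2 ∂ρ := by
  set c := ∫ z, g z ∂ρ with hc
  have h : 0 ≤ ∫ z, (g z - c) ^ 2 ∂ρ := integral_nonneg fun z => sq_nonneg _
  have e : (fun z => (g z - c) ^ 2) = fun z => g z ^ 2 + -2 * c * g z + c ^ 2 := by ext; ring
  rw [e, integral_add (hg2.fun_add (hg.const_mul _)) (integrable_const _),
    integral_add hg2 (hg.const_mul _), integral_const_mul, ← hc] at h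
  simp only [integral_const, probReal_univ, smul_eq_mul] at h
  linarith

/-- The Efron–Stein inequality for two independent variables: the variance of a bounded function
is at most the sum of the expected partial variances. -/
lemma variance_prod_le {X Y : Type*} [MeasurableSpace X] [MeasurableSpace Y] {μ : Measure X}
    {ν : Measure Y} [IsProbabilityMeasure μ] [IsProbabilityMeasure ν] {u : X × Y → ℝ}
    (hu : StronglyMeasurable u) {C : ℝ} (hC : ∀ z, |u z| ≤ C) :
    (∫ z, u z ^ 2 ∂(μ.prod ν)) - (∫ z, u z ∂(μ.prod ν)) ^ 2 ≤
      (∫ y, ((∫ x, u (x, y) ^ 2 ∂μ) - (∫ x, u (x, y) ∂μ) ^ 2) ∂ν) +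
        ∫ x, ((∫ y, u (x, y) ^ 2 ∂ν) - (∫ y, u (x, y) ∂ν) ^ 2) ∂μ := by
  set m := ∫ z, u z ∂(μ.prod ν) with hm
  set U : Y → ℝ := fun y => ∫ x, u (x, y) ∂μ with hU
  set W : X → ℝ := fun x => ∫ y, u (x, y) ∂ν with hW
  have hUm : StronglyMeasurable U := hu.integral_prod_left'
  have hWm : StronglyMeasurable W := hu.integral_prod_right'
  have hUC : ∀ y, |U y| ≤ C := fun y => abs_integral_le_of_abs_le fun x => hC (x, y)
  have hWC : ∀ x, |W x| ≤ C := fun x => abs_integral_le_of_abs_le fun y => hC (x, y)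
  have sqle : ∀ {a : ℝ}, |a| ≤ C → |a ^ 2| ≤ C ^ 2 := fun {a} ha => by
    rw [abs_pow]; exact pow_le_pow_left₀ (abs_nonneg _) ha 2
  have hu1 : Integrable u (μ.prod ν) := integrable_of_abs_le hu hC
  have hu2 : Integrable (fun z => u z ^ 2) (μ.prod ν) :=
    integrable_of_abs_le (hu.pow 2) fun z => sqle (hC z)
  have hU1 : Integrable U ν := integrable_of_abs_le hUm hUC
  have hU2 : Integrable (fun y => U y ^ 2) ν :=
    integrable_of_abs_le (hUm.pow 2) fun y => sqle (hUC y)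
  have hW2 : Integrable (fun x => W x ^ 2) μ :=
    integrable_of_abs_le (hWm.pow 2) fun x => sqle (hWC x)
  have hWm' : StronglyMeasurable fun z : X × Y => W z.1 := hWm.comp_measurable measurable_fst
  have huW : Integrable (fun z : X × Y => u z * W z.1) (μ.prod ν) :=
    integrable_of_abs_le (hu.mul hWm') (D := C * C) fun z => by
      rw [abs_mul]
      exact mul_le_mul (hC z) (hWC _) (abs_nonneg _) ((abs_nonneg _).trans (hC z))
  have hWp : Integrable (fun z : X × Y => W z.1) (μ.prod ν) :=
    integrable_of_abs_le hWm' fun z => hWC _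
  have hW2p : Integrable (fun z : X × Y => W z.1 ^ 2) (μ.prod ν) := hW2.comp_fst ν
  have e1 : ∫ z, u z * W z.1 ∂(μ.prod ν) = ∫ x, W x ^ 2 ∂μ := by
    rw [integral_prod _ huW]
    refine integral_congr_ae (ae_of_all _ fun x => ?_)
    simp only [integral_mul_const]
    rw [sq]
  have e2 : ∫ z, W z.1 ^ 2 ∂(μ.prod ν) = ∫ x, W x ^ 2 ∂μ := by
    rw [integral_prod _ hW2p]; simp
  have e3 : ∫ y, U y ∂ν = m := (integral_prod_symm _ hu1).symm
  have e4 : ∫ x, W x ∂μ = m := (integral_prod _ hu1).symm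
  have e : (fun z : X × Y => (u z - W z.1) ^ 2) =
      fun z => u z ^ 2 + -2 * (u z * W z.1) + W z.1 ^ 2 := by ext; ring
  have hd2 : Integrable (fun z : X × Y => (u z - W z.1) ^ 2) (μ.prod ν) := by
    rw [e]; exact (hu2.fun_add (huW.const_mul _)).fun_add hW2p
  have hd : ∫ z, (u z - W z.1) ^ 2 ∂(μ.prod ν) = (∫ z, u z ^ 2 ∂(μ.prod ν)) - ∫ x, W x ^ 2 ∂μ := by
    rw [e, integral_add (hu2.fun_add (huW.const_mul _)) hW2p, integral_add hu2 (huW.const_mul _),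
      integral_const_mul, e1, e2]
    ring
  have slice : ∀ {g : X × Y → ℝ} {D : ℝ}, StronglyMeasurable g → (∀ z, |g z| ≤ D) → ∀ y,
      Integrable (fun x => g (x, y)) μ := fun hg hD y =>
    integrable_of_abs_le (hg.comp_measurable measurable_prodMk_right) fun x => hD (x, y)
  have hdC : ∀ z : X × Y, |u z - W z.1| ≤ C + C := fun z =>
    (abs_sub _ _).trans (add_le_add (hC z) (hWC _))
  -- Since W has mean m, the quantity U(y) - m is the x-average of u - W, and Jensen bounds the
  -- variance of U by the expected partial variance in y. Adding the expected partial variance in x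
  -- gives the total.
  have key : ∫ y, (U y - m) ^ 2 ∂ν ≤ ∫ z, (u z - W z.1) ^ 2 ∂(μ.prod ν) := by
    rw [integral_prod_symm _ hd2]
    refine integral_mono_of_nonneg (ae_of_all _ fun y => sq_nonneg _) hd2.integral_prod_right
      (ae_of_all _ fun y => ?_)
    have i1 := slice hu hC y
    have i2 := slice hWm' (fun z => hWC z.1) y
    have h1 : U y - m = ∫ x, (u (x, y) - W x) ∂μ := by
      rw [integral_sub i1 i2, e4]
    simp only [h1]
    exact sq_integral_le_integral_sq (i1.sub i2) (slice ((hu.sub hWm').pow 2)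
      (D := (C + C) ^ 2) (fun z => by
        simp only [Pi.pow_apply, Pi.sub_apply, abs_pow]
        exact pow_le_pow_left₀ (abs_nonneg _) (hdC z) 2) y)
  have e5 : ∫ y, (U y - m) ^ 2 ∂ν = (∫ y, U y ^ 2 ∂ν) - m ^ 2 := by
    have e' : (fun y => (U y - m) ^ 2) = fun y => U y ^ 2 + -2 * m * U y + m ^ 2 := by ext; ring
    rw [e', integral_add (hU2.fun_add (hU1.const_mul _)) (integrable_const _),
      integral_add hU2 (hU1.const_mul _), integral_const_mul, e3]
    simp only [integral_const, probReal_univ, smul_eq_mul]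
    ring
  rw [integral_sub hu2.integral_prod_right hU2, integral_sub hu2.integral_prod_left hW2,
    ← integral_prod_symm _ hu2, ← integral_prod _ hu2]
  linarith

/-! The induction on the number of factors. -/

/-- The linear embedding of the last coordinates. -/
def consZero (n : ℕ) : (Fin n → ℝ) →L[ℝ] (Fin (n + 1) → ℝ) :=
  ContinuousLinearMap.pi (Fin.cases 0 fun i => ContinuousLinearMap.proj i)

lemma cons_eq_single_add (n : ℕ) (a : ℝ) (z : Fin n → ℝ) :
    (Fin.cons a z : Fin (n + 1) → ℝ) = Pi.single 0 a + consZero n z := by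
  ext i
  refine Fin.cases ?_ (fun i => ?_) i <;> simp [consZero]

lemma consZero_single (n : ℕ) (i : Fin n) (a : ℝ) :
    consZero n (Pi.single i a) = Pi.single i.succ a := by
  ext j
  refine Fin.cases ?_ (fun j => ?_) j
  · simp [consZero]
  · simp [consZero, Pi.single_apply]

lemma hasFDerivAt_cons_right (n : ℕ) (a : ℝ) (z : Fin n → ℝ) :
    HasFDerivAt (fun z : Fin n → ℝ => (Fin.cons a z : Fin (n + 1) → ℝ)) (consZero n) z := by
  simp only [cons_eq_single_add]
  exact (consZero n).hasFDerivAt.const_add _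

lemma hasDerivAt_cons_left (n : ℕ) (a : ℝ) (z : Fin n → ℝ) :
    HasDerivAt (fun a : ℝ => (Fin.cons a z : Fin (n + 1) → ℝ)) (Pi.single 0 1) a := by
  rw [hasDerivAt_pi]
  refine Fin.cases ?_ fun i => ?_
  · simpa using hasDerivAt_id' a
  · simpa using hasDerivAt_const a (z i)

lemma continuous_cons (n : ℕ) :
    Continuous fun z : ℝ × (Fin n → ℝ) => (Fin.cons z.1 z.2 : Fin (n + 1) → ℝ) := by
  refine continuous_pi (Fin.cases ?_ fun i => ?_)
  · simpa using continuous_fst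
  · simp only [Fin.cons_succ]
    fun_prop

lemma integral_pi_succ {n : ℕ} {μ : Measure ℝ} [SigmaFinite μ] (G : (Fin (n + 1) → ℝ) → ℝ) :
    ∫ x, G x ∂(Measure.pi fun _ => μ) =
      ∫ z, G (Fin.cons z.1 z.2) ∂(μ.prod (Measure.pi fun _ : Fin n => μ)) := by
  rw [← ((measurePreserving_piFinSuccAbove (fun _ : Fin (n + 1) => μ) 0).symm).integral_comp']
  refine integral_congr_ae (ae_of_all _ fun z => ?_)
  simp [MeasurableEquiv.piFinSuccAbove_symm_apply, Fin.insertNthEquiv]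

/-- The Poincaré inequality for products of the logistic measure. -/
lemma poincare_pi_logisticMeasure (n : ℕ) {u : (Fin n → ℝ) → ℝ} (hu : ContDiff ℝ 1 u)
    (hs : HasCompactSupport u) :
    (∫ x, u x ^ 2 ∂(Measure.pi fun _ => logisticMeasure)) -
        (∫ x, u x ∂(Measure.pi fun _ => logisticMeasure)) ^ 2 ≤
      4 * ∑ i, ∫ x, fderiv ℝ u x (Pi.single i 1) ^ 2 ∂(Measure.pi fun _ => logisticMeasure) := by
  induction n with
  | zero => simp [integral_unique, measureReal_def]
  | succ n ih =>
    have hd := hu.differentiable (by simp)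
    have hfc : ∀ e, Continuous fun x => fderiv ℝ u x e := fun e =>
      (hu.continuous_fderiv (by simp)).clm_apply continuous_const
    have hfs : ∀ e, HasCompactSupport fun x => fderiv ℝ u x e := fun e =>
      (hs.fderiv (𝕜 := ℝ)).comp_left (g := fun L : (Fin (n + 1) → ℝ) →L[ℝ] ℝ => L e) (by simp)
    have hcc := continuous_cons n
    obtain ⟨C, hC⟩ := hs.exists_bound_of_continuous hu.continuous
    have hES := variance_prod_le (μ := logisticMeasure)
      (ν := Measure.pi fun _ : Fin n => logisticMeasure)
      (hu.continuous.comp hcc).stronglyMeasurable (fun z => hC _)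
    simp only [Function.comp_apply] at hES
    have hint : ∀ e, Integrable (fun z : ℝ × (Fin n → ℝ) => fderiv ℝ u (Fin.cons z.1 z.2) e ^ 2)
        (logisticMeasure.prod (Measure.pi fun _ : Fin n => logisticMeasure)) := fun e => by
      obtain ⟨D, hD⟩ := (hfs e).exists_bound_of_continuous (hfc e)
      refine integrable_of_abs_le (((hfc e).comp hcc).pow 2).stronglyMeasurable (D := D ^ 2)
        fun z => ?_
      rw [abs_pow]
      exact pow_le_pow_left₀ (abs_nonneg _) (hD _) 2
    -- Slices are closed embeddings, so restrictions to them keep compact support and the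
    -- lower-dimensional inequalities apply.
    have emb1 : ∀ z : Fin n → ℝ,
        IsClosedEmbedding fun a : ℝ => (Fin.cons a z : Fin (n + 1) → ℝ) := fun z =>
      Function.LeftInverse.isClosedEmbedding (f := fun x : Fin (n + 1) → ℝ => x 0)
        (fun a => by simp) (continuous_apply 0) (hcc.comp (by fun_prop : Continuous fun a => (a, z)))
    have emb2 : ∀ a : ℝ,
        IsClosedEmbedding fun z : Fin n → ℝ => (Fin.cons a z : Fin (n + 1) → ℝ) := fun a =>
      Function.LeftInverse.isClosedEmbedding (f := fun (x : Fin (n + 1) → ℝ) i => x (Fin.succ i))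
        (fun a => by simp) (by fun_prop) (hcc.comp (by fun_prop : Continuous fun z => (a, z)))
    have h1 : ∀ z : Fin n → ℝ, (∫ a, u (Fin.cons a z) ^ 2 ∂logisticMeasure) -
        (∫ a, u (Fin.cons a z) ∂logisticMeasure) ^ 2 ≤
        ∫ a, 4 * fderiv ℝ u (Fin.cons a z) (Pi.single 0 1) ^ 2 ∂logisticMeasure := fun z => by
      rw [integral_const_mul]
      simp only [integral_logisticMeasure]
      exact poincare_logistic (u := fun a => u (Fin.cons a z))
        (u' := fun a => fderiv ℝ u (Fin.cons a z) (Pi.single 0 1))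
        (fun a => (hd _).hasFDerivAt.comp_hasDerivAt a (hasDerivAt_cons_left n a z))
        ((hfc _).comp (emb1 z).continuous) (hs.comp_isClosedEmbedding (emb1 z))
        ((hfs _).comp_isClosedEmbedding (emb1 z))
    have h2 : ∀ a : ℝ, (∫ z, u (Fin.cons a z) ^ 2 ∂(Measure.pi fun _ : Fin n => logisticMeasure)) -
        (∫ z, u (Fin.cons a z) ∂(Measure.pi fun _ : Fin n => logisticMeasure)) ^ 2 ≤
        4 * ∑ i : Fin n, ∫ z, fderiv ℝ u (Fin.cons a z) (Pi.single i.succ 1) ^ 2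
          ∂(Measure.pi fun _ : Fin n => logisticMeasure) := fun a => by
      have hca : ContDiff ℝ 1 fun z : Fin n → ℝ => (Fin.cons a z : Fin (n + 1) → ℝ) := by
        simp only [cons_eq_single_add]
        exact contDiff_const.add (consZero n).contDiff
      have := ih (u := fun z => u (Fin.cons a z)) (hu.comp hca) (hs.comp_isClosedEmbedding (emb2 a))
      have e : ∀ (z : Fin n → ℝ) i, fderiv ℝ (fun z => u (Fin.cons a z)) z (Pi.single i 1) =
          fderiv ℝ u (Fin.cons a z) (Pi.single i.succ 1) := fun z i => by
        have := ((hd (Fin.cons a z)).hasFDerivAt.comp z (hasFDerivAt_cons_right n a z)).fderiv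
        rw [← consZero_single]
        exact congrArg (fun L => L (Pi.single i 1)) this
      simpa only [e] using this
    rw [Fin.sum_univ_succ]
    simp only [integral_pi_succ]
    have hu2 : ∀ z, |u z ^ 2| ≤ C ^ 2 := fun z => by
      rw [abs_pow]; exact pow_le_pow_left₀ (abs_nonneg _) (hC z) 2
    have b1 : ∫ z, ((∫ a, u (Fin.cons a z) ^ 2 ∂logisticMeasure) -
        (∫ a, u (Fin.cons a z) ∂logisticMeasure) ^ 2)
          ∂(Measure.pi fun _ : Fin n => logisticMeasure) ≤
        4 * ∫ z, fderiv ℝ u (Fin.cons z.1 z.2) (Pi.single 0 1) ^ 2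
          ∂(logisticMeasure.prod (Measure.pi fun _ : Fin n => logisticMeasure)) := by
      rw [← integral_const_mul, integral_prod_symm _ ((hint _).const_mul 4)]
      refine integral_mono_of_nonneg (ae_of_all _ fun z => sub_nonneg.2 ?_)
        ((hint _).const_mul 4).integral_prod_right (ae_of_all _ h1)
      have hc := hu.continuous.comp (emb1 z).continuous
      exact sq_integral_le_integral_sq (integrable_of_abs_le hc.stronglyMeasurable fun a => hC _)
        (integrable_of_abs_le (hc.pow 2).stronglyMeasurable fun a => hu2 _)
    have b2 : ∫ a, ((∫ z, u (Fin.cons a z) ^ 2 ∂(Measure.pi fun _ : Fin n => logisticMeasure)) -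
        (∫ z, u (Fin.cons a z) ∂(Measure.pi fun _ : Fin n => logisticMeasure)) ^ 2)
          ∂logisticMeasure ≤
        4 * ∑ i : Fin n, ∫ z, fderiv ℝ u (Fin.cons z.1 z.2) (Pi.single i.succ 1) ^ 2
          ∂(logisticMeasure.prod (Measure.pi fun _ : Fin n => logisticMeasure)) := by
      have e : ∀ i : Fin n, ∫ z, fderiv ℝ u (Fin.cons z.1 z.2) (Pi.single i.succ 1) ^ 2
          ∂(logisticMeasure.prod (Measure.pi fun _ : Fin n => logisticMeasure)) = _ :=
        fun i => integral_prod _ (hint _)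
      simp only [e]
      rw [← integral_finsetSum _ fun i _ => (hint _).integral_prod_left, ← integral_const_mul]
      refine integral_mono_of_nonneg (ae_of_all _ fun z => sub_nonneg.2 ?_)
        ((integrable_finsetSum _ fun i _ => (hint _).integral_prod_left).const_mul 4)
        (ae_of_all _ h2)
      have hc := hu.continuous.comp (emb2 z).continuous
      exact sq_integral_le_integral_sq (integrable_of_abs_le hc.stronglyMeasurable fun a => hC _)
        (integrable_of_abs_le (hc.pow 2).stronglyMeasurable fun a => hu2 _)
    linarith


section

/-! ### Geometry of half-spaces -/

lemma sdist_halfSpace {d : ℕ} {v : Euc d} (hv : ‖v‖ = 1) (t : ℝ) (x : Euc d) :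
    sdist (halfSpace v t) x = ⟪x, v⟫_ℝ - t := by
  have hvv : ⟪v, v⟫_ℝ = 1 := by rw [real_inner_self_eq_norm_sq, hv]; norm_num
  have hmove : ∀ r : ℝ, ⟪x - r • v, v⟫_ℝ = ⟪x, v⟫_ℝ - r := fun r => by
    rw [inner_sub_left, real_inner_smul_left, hvv, mul_one]
  have hdist : ∀ r : ℝ, dist x (x - r • v) = |r| := fun r => by
    simp [norm_smul, hv]
  have hlip : ∀ y : Euc d, |⟪x, v⟫_ℝ - ⟪y, v⟫_ℝ| ≤ dist x y := fun y => by
    rw [← inner_sub_left, dist_eq_norm]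
    simpa [hv] using abs_real_inner_le_norm (x - y) v
  unfold sdist
  rcases le_or_gt t ⟪x, v⟫_ℝ with h | h
  · have hx : x ∈ (halfSpace v t)ᶜ := by simpa [halfSpace] using h
    -- The half-space is open, so the orthogonal projection onto the boundary is not in it;
    -- overshooting by ε gives the distance in the limit.
    have hmem : ∀ ε > 0, x - (⟪x, v⟫_ℝ - t + ε) • v ∈ halfSpace v t := fun ε hε => by
      rw [halfSpace, mem_ofPred_eq, hmove]; linarith
    rw [Metric.infDist_zero_of_mem hx, sub_zero]
    apply le_antisymm
    · refine le_of_forall_pos_le_add fun ε hε => ?_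
      refine (Metric.infDist_le_dist_of_mem (hmem ε hε)).trans ?_
      rw [hdist, abs_of_nonneg (by linarith)]
    · refine (Metric.le_infDist ⟨_, hmem 1 one_pos⟩).2 fun y hy => ?_
      have hy : ⟪y, v⟫_ℝ < t := hy
      linarith [hlip y, le_abs_self (⟪x, v⟫_ℝ - ⟪y, v⟫_ℝ)]
  · have hx : x ∈ halfSpace v t := h
    have hmem : x - (⟪x, v⟫_ℝ - t) • v ∈ (halfSpace v t)ᶜ := by
      rw [halfSpace, mem_compl_iff, mem_ofPred_eq, hmove]; linarith
    rw [Metric.infDist_zero_of_mem hx, zero_sub, neg_eq_iff_eq_neg, neg_sub]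
    apply le_antisymm
    · refine (Metric.infDist_le_dist_of_mem hmem).trans ?_
      rw [hdist, abs_of_neg (by linarith), neg_sub]
    · refine (Metric.le_infDist ⟨_, hmem⟩).2 fun y hy => ?_
      have hy : t ≤ ⟪y, v⟫_ℝ := by simpa [halfSpace] using hy
      linarith [hlip y, neg_le_abs (⟪x, v⟫_ℝ - ⟪y, v⟫_ℝ)]

lemma normal_halfSpace {d : ℕ} {v : Euc d} (hv : ‖v‖ = 1) (t : ℝ) :
    normal (halfSpace v t) = fun _ => v := by
  ext1 x
  rw [normal, funext (sdist_halfSpace hv t)]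
  apply HasGradientAt.gradient
  rw [hasGradientAt_iff_hasFDerivAt]
  refine HasFDerivAt.sub_const t ?_
  refine ((InnerProductSpace.toDual ℝ (Euc d) v).hasFDerivAt (x := x)).congr_of_eventuallyEq
    (Eventually.of_forall fun y => ?_)
  simp [real_inner_comm]

lemma shape_halfSpace {d : ℕ} {v : Euc d} (hv : ‖v‖ = 1) (t : ℝ) (x : Euc d) :
    shape (halfSpace v t) x = 0 := by
  rw [shape, normal_halfSpace hv]; simp

lemma isOpenC2_halfSpace {d : ℕ} {v : Euc d} (hv : ‖v‖ = 1) (t : ℝ) :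
    IsOpenC2 (halfSpace v t) := by
  refine ⟨isOpen_lt (by fun_prop) continuous_const, fun p _ => ?_⟩
  rw [funext (sdist_halfSpace hv t)]
  exact ((contDiff_id.inner ℝ contDiff_const).sub contDiff_const).contDiffAt

lemma frontier_halfSpace {d : ℕ} {v : Euc d} (hv : ‖v‖ = 1) (t : ℝ) :
    frontier (halfSpace v t) = {x | ⟪x, v⟫_ℝ = t} := by
  set L := InnerProductSpace.toDual ℝ (Euc d) v
  have hL : ∀ x, L x = ⟪x, v⟫_ℝ := fun x => by simp [L, real_inner_comm]
  have hsurj : Function.Surjective L := fun r => ⟨r • v, by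
    rw [hL, real_inner_smul_left, real_inner_self_eq_norm_sq, hv]; simp⟩
  have h1 : halfSpace v t = L ⁻¹' Iio t := by ext x; simp [halfSpace, hL]
  rw [h1, ← (L.isOpenMap hsurj).preimage_frontier_eq_frontier_preimage L.continuous, frontier_Iio]
  ext x; simp [hL]

/-- An isometric affine parametrization of the boundary of a half-space. -/
structure BoundaryParam {N : ℕ} (v : Euc (N + 1)) (t : ℝ) where
  /-- The linear part. -/
  lin : Euc N →ₗᵢ[ℝ] Euc (N + 1)
  /-- The base point. -/
  base : Euc (N + 1)
  range_eq : range (fun y => base + lin y) = {x | ⟪x, v⟫_ℝ = t}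

/-- The parametrization as a map. -/
def BoundaryParam.map {N : ℕ} {v : Euc (N + 1)} {t : ℝ} (P : BoundaryParam v t) (y : Euc N) :
    Euc (N + 1) := P.base + P.lin y

variable {N : ℕ} {v : Euc (N + 1)} {t : ℝ}

lemma BoundaryParam.inner_map (P : BoundaryParam v t) (y : Euc N) : ⟪P.map y, v⟫_ℝ = t :=
  P.range_eq.subset (mem_range_self y)

lemma BoundaryParam.isometry (P : BoundaryParam v t) : Isometry P.map :=
  Isometry.of_dist_eq fun x y => by simp [BoundaryParam.map]

lemma BoundaryParam.inner_lin (P : BoundaryParam v t) (y : Euc N) : ⟪P.lin y, v⟫_ℝ = 0 := by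
  have h1 := P.inner_map y
  have h2 := P.inner_map 0
  simp only [BoundaryParam.map, inner_add_left, map_zero, inner_zero_left] at h1 h2
  linarith

lemma BoundaryParam.exists_lin_eq (P : BoundaryParam v t) {w : Euc (N + 1)}
    (hw : ⟪w, v⟫_ℝ = 0) : ∃ y, P.lin y = w := by
  have h2 := P.inner_map 0
  simp only [BoundaryParam.map, map_zero, add_zero] at h2
  have : P.base + w ∈ range (fun y => P.base + P.lin y) := by
    rw [P.range_eq, mem_ofPred_eq, inner_add_left, hw, h2, add_zero]
  obtain ⟨y, hy⟩ := this
  exact ⟨y, add_left_cancel hy⟩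

/-- Isometries transport Hausdorff measure, and the Euclidean normalization makes it Lebesgue
measure on the chart. -/
lemma BoundaryParam.area_eq (P : BoundaryParam v t) (hv : ‖v‖ = 1) :
    area (halfSpace v t) = volume.map P.map := by
  rw [area, frontier_halfSpace hv, ← P.range_eq,
    ← EuclideanSpace.euclideanHausdorffMeasure_eq_volume, P.isometry.map_euclideanHausdorffMeasure]
  rfl

lemma BoundaryParam.integral_area (P : BoundaryParam v t) (hv : ‖v‖ = 1) (G : Euc (N + 1) → ℝ) :
    ∫ x, G x ∂(area (halfSpace v t)) = ∫ y, G (P.map y) := by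
  rw [P.area_eq hv, P.isometry.isClosedEmbedding.measurableEmbedding.integral_map]

lemma BoundaryParam.hasFDerivAt_map (P : BoundaryParam v t) (y : Euc N) :
    HasFDerivAt P.map P.lin.toContinuousLinearMap y :=
  P.lin.toContinuousLinearMap.hasFDerivAt.const_add _

/-- The tangential gradient is orthogonal to `v`, hence in the range of the isometry `P.lin`; its
preimage represents the derivative of the pulled-back function. -/
lemma BoundaryParam.norm_tanGradient (P : BoundaryParam v t) (hv : ‖v‖ = 1)
    {u : Euc (N + 1) → ℝ} (hu : Differentiable ℝ u) (y : Euc N) :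
    ‖tanGradient (halfSpace v t) u (P.map y)‖ = ‖gradient (u ∘ P.map) y‖ := by
  have hvv : ⟪v, v⟫_ℝ = 1 := by rw [real_inner_self_eq_norm_sq, hv]; norm_num
  rw [tanGradient, normal_halfSpace hv]
  set g := gradient u (P.map y) with hg
  obtain ⟨k, hk⟩ := P.exists_lin_eq (w := g - ⟪g, v⟫_ℝ • v) (by
    rw [inner_sub_left, real_inner_smul_left, hvv]; ring)
  have hgrad : HasGradientAt (u ∘ P.map) k y := by
    rw [hasGradientAt_iff_hasFDerivAt]
    have h := (hu (P.map y)).hasFDerivAt.comp y (P.hasFDerivAt_map y)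
    refine h.congr_fderiv (ContinuousLinearMap.ext fun z => ?_)
    have h1 : ⟪g, P.lin z⟫_ℝ = fderiv ℝ u (P.map y) (P.lin z) := by
      rw [hg, gradient, InnerProductSpace.toDual_symm_apply]
    have h2 : ⟪k, z⟫_ℝ = ⟪g, P.lin z⟫_ℝ := by
      rw [← P.lin.inner_map_map, hk, inner_sub_left, real_inner_smul_left,
        real_inner_comm (P.lin z) v, P.inner_lin, mul_zero, sub_zero]
    simp only [InnerProductSpace.toDual_apply_apply, ContinuousLinearMap.comp_apply]
    exact (h2.trans h1).symm
  rw [hgrad.gradient, ← hk, P.lin.norm_map]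

/-! ### The logarithm of the product density -/

lemma logisticProdDensity_pos {d : ℕ} (x : Euc d) : 0 < logisticProdDensity d x :=
  Finset.prod_pos fun _ _ => logisticDensity_pos _

lemma continuous_logisticProdDensity (d : ℕ) : Continuous (logisticProdDensity d) :=
  continuous_finsetProd _ fun i _ => continuous_logisticDensity.comp (by fun_prop)

lemma hasFDerivAt_apply_euc {d : ℕ} (i : Fin d) (x : Euc d) :
    HasFDerivAt (fun y : Euc d => y i) (EuclideanSpace.proj i : Euc d →L[ℝ] ℝ) x :=
  (EuclideanSpace.proj i : Euc d →L[ℝ] ℝ).hasFDerivAt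

lemma gradient_log_logisticProdDensity (d : ℕ) :
    gradient (fun y => Real.log (logisticProdDensity d y)) =
      fun x => WithLp.toLp 2 fun i => -slope (x i) := by
  ext1 x
  apply HasGradientAt.gradient
  have e : (fun y => Real.log (logisticProdDensity d y)) =
      fun y : Euc d => ∑ i, Real.log (logisticDensity (y i)) := by
    ext y
    exact Real.log_prod fun i _ => (logisticDensity_pos _).ne'
  rw [hasGradientAt_iff_hasFDerivAt, e]
  have h : ∀ i ∈ Finset.univ, HasFDerivAt (fun y : Euc d => Real.log (logisticDensity (y i)))
      (-slope (x i) • (EuclideanSpace.proj i : Euc d →L[ℝ] ℝ)) x := fun i _ =>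
    HasDerivAt.comp_hasFDerivAt (f := fun y : Euc d => y i) x
      (hasDerivAt_log_logisticDensity (x i)) (hasFDerivAt_apply_euc i x)
  refine (HasFDerivAt.fun_sum h).congr_fderiv (ContinuousLinearMap.ext fun z => ?_)
  simp [PiLp.inner_apply, mul_comm]

lemma inner_hessian_log_logisticProdDensity {d : ℕ} (x v : Euc d) :
    ⟪fderiv ℝ (gradient (fun y => Real.log (logisticProdDensity d y))) x v, v⟫_ℝ =
      -2 * ∑ i, v i ^ 2 * logisticDensity (x i) := by
  rw [gradient_log_logisticProdDensity]
  have h : HasFDerivAt (fun x : Euc d => (WithLp.toLp 2 fun i => -slope (x i) : Euc d))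
      ((PiLp.continuousLinearEquiv 2 ℝ (fun _ : Fin d => ℝ)).symm.toContinuousLinearMap.comp
        (ContinuousLinearMap.pi fun i => -(2 * logisticDensity (x i)) •
          (EuclideanSpace.proj i : Euc d →L[ℝ] ℝ))) x := by
    refine (PiLp.continuousLinearEquiv 2 ℝ
      (fun _ : Fin d => ℝ)).symm.toContinuousLinearMap.hasFDerivAt.comp x ?_
    rw [hasFDerivAt_pi]
    exact fun i => HasDerivAt.comp_hasFDerivAt (f := fun y : Euc d => y i) x
      (hasDerivAt_slope (x i)).fun_neg (hasFDerivAt_apply_euc i x)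
  rw [h.fderiv]
  simp only [PiLp.inner_apply, Finset.mul_sum]
  refine Finset.sum_congr rfl fun i _ => ?_
  simp
  ring

/-! ### Stationarity and stability of half-spaces -/

lemma isStationary_halfSpace_iff (hv : ‖v‖ = 1) :
    IsStationary (logisticProdDensity (N + 1)) (halfSpace v t) ↔
      ∃ c : ℝ, ∀ x : Euc (N + 1), ⟪x, v⟫_ℝ = t → ∑ i, v i * slope (x i) = c := by
  have h : ∀ x, genMeanCurv (logisticProdDensity (N + 1)) (halfSpace v t) x =
      ∑ i, v i * slope (x i) := fun x => by
    rw [genMeanCurv, sumCurv, shape_halfSpace hv, normal_halfSpace hv,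
      gradient_log_logisticProdDensity]
    simp [PiLp.inner_apply]
  simp only [IsStationary, isOpenC2_halfSpace hv t, true_and, frontier_halfSpace hv, h,
    mem_ofPred_eq]

/-- With zero curvature, only the Dirichlet term and the Hessian of the log-density, diagonal with
entries -2 f(x_i), survive. Every later stability question is about this flat quadratic form. -/
lemma BoundaryParam.secondVariation_eq (P : BoundaryParam v t) (hv : ‖v‖ = 1)
    {u : Euc (N + 1) → ℝ} (hu : Differentiable ℝ u) :
    secondVariation (logisticProdDensity (N + 1)) (halfSpace v t) u =
      (∫ y, logisticProdDensity (N + 1) (P.map y) * ‖gradient (u ∘ P.map) y‖ ^ 2) -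
      2 * ∫ y, logisticProdDensity (N + 1) (P.map y) * (u (P.map y) ^ 2 *
        ∑ i, v i ^ 2 * logisticDensity (P.map y i)) := by
  rw [secondVariation, P.integral_area hv, P.integral_area hv, ← integral_const_mul,
    sub_eq_add_neg, ← integral_neg]
  congr 1
  · refine integral_congr_ae (ae_of_all _ fun y => ?_)
    simp only [P.norm_tanGradient hv hu, sumSqCurv, shape_halfSpace hv]
    simp
  · refine integral_congr_ae (ae_of_all _ fun y => ?_)
    simp only [normal_halfSpace hv, inner_hessian_log_logisticProdDensity]
    ring

end

section

/-! ### Coordinate half-spaces -/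

lemma integral_euc {n : ℕ} (G : Euc n → ℝ) :
    ∫ y, G y = ∫ x : Fin n → ℝ, G (WithLp.toLp 2 x) :=
  ((PiLp.volume_preserving_toLp (Fin n)).integral_comp
    (MeasurableEquiv.toLp 2 (Fin n → ℝ)).measurableEmbedding G).symm

lemma norm_gradient_sq {n : ℕ} (w : Euc n → ℝ) (y : Euc n) :
    ‖gradient w y‖ ^ 2 = ∑ i, fderiv ℝ w y (EuclideanSpace.single i 1) ^ 2 := by
  rw [EuclideanSpace.real_norm_sq_eq]
  refine Finset.sum_congr rfl fun i _ => ?_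
  have : ⟪gradient w y, EuclideanSpace.single i (1 : ℝ)⟫_ℝ =
      fderiv ℝ w y (EuclideanSpace.single i 1) := by
    rw [gradient, InnerProductSpace.toDual_symm_apply]
  rw [← this, EuclideanSpace.inner_single_right]
  simp

/-- The Poincaré inequality for the product density on Euclidean space. -/
lemma poincare_logisticProdDensity {n : ℕ} {w : Euc n → ℝ} (hw : ContDiff ℝ 1 w)
    (hs : HasCompactSupport w) :
    (∫ y, logisticProdDensity n y * w y ^ 2) - (∫ y, logisticProdDensity n y * w y) ^ 2 ≤
      4 * ∫ y, logisticProdDensity n y * ‖gradient w y‖ ^ 2 := by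
  set T := (PiLp.continuousLinearEquiv 2 ℝ (fun _ : Fin n => ℝ)).symm with hT
  have hTc : ContDiff ℝ 1 (fun x : Fin n → ℝ => w (T x)) := hw.comp T.contDiff
  have hTs : HasCompactSupport (fun x : Fin n → ℝ => w (T x)) :=
    hs.comp_homeomorph T.toHomeomorph
  have h := poincare_pi_logisticMeasure n hTc hTs
  have hd : ∀ (x : Fin n → ℝ) i, fderiv ℝ (fun x => w (T x)) x (Pi.single i 1) =
      fderiv ℝ w (T x) (EuclideanSpace.single i 1) := fun x i => by
    have := ((hw.differentiable (by simp) (T x)).hasFDerivAt.comp x T.hasFDerivAt).fderiv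
    exact congrArg (fun L => L (Pi.single i 1)) this
  have hint : ∀ i ∈ Finset.univ, Integrable
      (fun x : Fin n → ℝ => fderiv ℝ (fun x => w (T x)) x (Pi.single i 1) ^ 2)
      (Measure.pi fun _ : Fin n => logisticMeasure) := fun i _ => by
    have hc : Continuous fun x : Fin n → ℝ => fderiv ℝ (fun x => w (T x)) x (Pi.single i 1) :=
      (hTc.continuous_fderiv (by simp)).clm_apply continuous_const
    have hcs : HasCompactSupport
        fun x : Fin n → ℝ => fderiv ℝ (fun x => w (T x)) x (Pi.single i 1) :=
      (hTs.fderiv (𝕜 := ℝ)).comp_left (g := fun L : (Fin n → ℝ) →L[ℝ] ℝ => L (Pi.single i 1))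
        (by simp)
    exact (hc.pow 2).integrable_of_hasCompactSupport
      (hcs.mono fun x hx => by contrapose! hx; simp_all)
  rw [← integral_finsetSum _ hint] at h
  simp only [hd, integral_pi_logisticMeasure] at h
  simp only [integral_euc, norm_gradient_sq]
  exact h

/-- An isometric linear embedding that is diagonal in all but one coordinate of the target. -/
def graphIsometry {N : ℕ} (i : Fin (N + 1)) (a : Euc N →ₗ[ℝ] ℝ) (d : Fin N → ℝ)
    (h : ∀ y : Euc N, a y ^ 2 + ∑ m, (d m * y m) ^ 2 = ∑ m, y m ^ 2) :
    Euc N →ₗᵢ[ℝ] Euc (N + 1) where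
  toFun y := WithLp.toLp 2 (i.insertNth (a y) fun m => d m * y m)
  map_add' x y := by
    ext k
    revert k
    rw [Fin.forall_iff_succAbove i]
    simp [mul_add]
  map_smul' c y := by
    ext k
    revert k
    rw [Fin.forall_iff_succAbove i]
    simp [mul_left_comm]
  norm_map' y := by
    rw [← sq_eq_sq₀ (norm_nonneg _) (norm_nonneg _), EuclideanSpace.real_norm_sq_eq,
      EuclideanSpace.real_norm_sq_eq, Fin.sum_univ_succAbove _ i]
    simpa using h y

lemma graphIsometry_apply_same {N : ℕ} (i : Fin (N + 1)) (a : Euc N →ₗ[ℝ] ℝ) (d : Fin N → ℝ)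
    (h : ∀ y : Euc N, a y ^ 2 + ∑ m, (d m * y m) ^ 2 = ∑ m, y m ^ 2) (y : Euc N) :
    graphIsometry i a d h y i = a y := by
  change (i.insertNth (a y) fun m => d m * y m : Fin (N + 1) → ℝ) i = _
  simp

lemma graphIsometry_apply_succAbove {N : ℕ} (i : Fin (N + 1)) (a : Euc N →ₗ[ℝ] ℝ)
    (d : Fin N → ℝ) (h : ∀ y : Euc N, a y ^ 2 + ∑ m, (d m * y m) ^ 2 = ∑ m, y m ^ 2) (y : Euc N)
    (m : Fin N) : graphIsometry i a d h y (i.succAbove m) = d m * y m := by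
  change (i.insertNth (a y) fun m => d m * y m : Fin (N + 1) → ℝ) (i.succAbove m) = _
  simp

variable {N : ℕ} {v : Euc (N + 1)} {t : ℝ}

lemma sq_apply_eq_one_of_coordinate (hv : ‖v‖ = 1) {i : Fin (N + 1)}
    (hi : ∀ k, k ≠ i → v k = 0) : v i ^ 2 = 1 := by
  have h := EuclideanSpace.real_norm_sq_eq v
  rw [hv, Finset.sum_eq_single i (fun k _ hk => by simp [hi k hk]) (by simp)] at h
  linarith

lemma inner_of_coordinate {i : Fin (N + 1)} (hi : ∀ k, k ≠ i → v k = 0) (x : Euc (N + 1)) :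
    ⟪x, v⟫_ℝ = x i * v i := by
  rw [PiLp.inner_apply, Finset.sum_eq_single i (fun k _ hk => by simp [hi k hk]) (by simp)]
  simp [mul_comm]

/-- The parametrization of the boundary of a coordinate half-space by the other coordinates. -/
def coordinateParam (hv : ‖v‖ = 1) {i : Fin (N + 1)} (hi : ∀ k, k ≠ i → v k = 0) :
    BoundaryParam v t where
  lin := graphIsometry i 0 1 (by simp)
  base := EuclideanSpace.single i (t * v i)
  range_eq := by
    have hvi := sq_apply_eq_one_of_coordinate hv hi
    ext x
    rw [mem_range, mem_ofPred_eq, inner_of_coordinate hi]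
    constructor
    · rintro ⟨y, rfl⟩
      simp [graphIsometry_apply_same, mul_assoc, ← sq, hvi]
    · intro hx
      refine ⟨WithLp.toLp 2 fun m => x (i.succAbove m), ?_⟩
      ext k
      revert k
      rw [Fin.forall_iff_succAbove i]
      constructor
      · simp [graphIsometry_apply_same, ← hx, mul_assoc, ← sq, hvi]
      · simp [graphIsometry_apply_succAbove]

lemma coordinateParam_map_same (hv : ‖v‖ = 1) {i : Fin (N + 1)} (hi : ∀ k, k ≠ i → v k = 0)
    (y : Euc N) : (coordinateParam (t := t) hv hi).map y i = t * v i := by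
  simp [coordinateParam, BoundaryParam.map, graphIsometry_apply_same]

lemma coordinateParam_map_succAbove (hv : ‖v‖ = 1) {i : Fin (N + 1)}
    (hi : ∀ k, k ≠ i → v k = 0) (y : Euc N) (m : Fin N) :
    (coordinateParam (t := t) hv hi).map y (i.succAbove m) = y m := by
  simp [coordinateParam, BoundaryParam.map, graphIsometry_apply_succAbove]

lemma BoundaryParam.contDiff_comp (P : BoundaryParam v t) {u : Euc (N + 1) → ℝ} {n : WithTop ℕ∞}
    (hu : ContDiff ℝ n u) : ContDiff ℝ n (u ∘ P.map) :=
  hu.comp (contDiff_const.add P.lin.contDiff)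

lemma BoundaryParam.hasCompactSupport_comp (P : BoundaryParam v t) {u : Euc (N + 1) → ℝ}
    (hu : HasCompactSupport u) : HasCompactSupport (u ∘ P.map) :=
  hu.comp_isClosedEmbedding P.isometry.isClosedEmbedding

lemma logisticDensity_le_of_le_abs (ht : 2 * Real.log (2 + √3) ≤ |t|) :
    logisticDensity t ≤ 1 / 8 := by
  wlog h0 : 0 ≤ t generalizing t
  · rw [← logisticDensity_neg]
    exact this (by rwa [abs_neg]) (by linarith)
  rw [abs_of_nonneg h0] at ht
  have h3 : (0 : ℝ) ≤ √3 := Real.sqrt_nonneg 3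
  have h3' : √3 ^ 2 = 3 := Real.sq_sqrt (by norm_num)
  -- The hypothesis gives e^t ≥ (2 + √3)² = 7 + 4√3. The bound f(t) ≤ 1/8 needs only e^{2t} - 6e^t +
  -- 1 ≥ 0, for which e^t ≥ 7 suffices.
  have hE : 7 ≤ Real.exp t := by
    have := Real.exp_le_exp.2 ht
    rw [mul_comm, Real.exp_mul, Real.exp_log (by positivity)] at this
    norm_cast at this
    nlinarith
  rw [logisticDensity, div_le_div_iff₀ (by positivity) (by norm_num)]
  nlinarith

/-- Coordinate half-spaces far enough from the origin are stable. -/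
lemma isStable_of_coordinate (hv : ‖v‖ = 1) (hc : IsCoordinate v)
    (ht : 2 * Real.log (2 + √3) ≤ |t|) :
    IsStable (logisticProdDensity (N + 1)) (halfSpace v t) := by
  obtain ⟨i, hi⟩ := hc
  have hvi := sq_apply_eq_one_of_coordinate hv hi
  refine ⟨(isStationary_halfSpace_iff hv).2 ⟨v i * slope (t * v i), fun x hx => ?_⟩,
    fun u hu hs h0 => ?_⟩
  · rw [inner_of_coordinate hi] at hx
    rw [Finset.sum_eq_single i (fun k _ hk => by simp [hi k hk]) (by simp), ← hx, mul_assoc, ← sq,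
      hvi, mul_one]
  · set P : BoundaryParam v t := coordinateParam hv hi with hP
    have ht' : logisticDensity (t * v i) = logisticDensity t := by
      rcases (sq_eq_sq_iff_eq_or_eq_neg (b := (1 : ℝ))).1 (by rw [hvi, one_pow]) with h | h
      · simp [h]
      · simp [h, logisticDensity_neg]
    have hF : ∀ y, logisticProdDensity (N + 1) (P.map y) =
        logisticDensity t * logisticProdDensity N y := fun y => by
      rw [logisticProdDensity, Fin.prod_univ_succAbove _ i, hP, coordinateParam_map_same, ht']
      simp only [coordinateParam_map_succAbove, logisticProdDensity]
    have hq : ∀ y, ∑ k, v k ^ 2 * logisticDensity (P.map y k) = logisticDensity t := fun y => by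
      rw [Finset.sum_eq_single i (fun k _ hk => by simp [hi k hk]) (by simp), hP,
        coordinateParam_map_same, ht', hvi, one_mul]
    have hft := logisticDensity_pos t
    have hu1 : ContDiff ℝ 1 u := hu.of_le (by exact_mod_cast le_top)
    rw [P.integral_area hv] at h0
    have hmean : ∫ y, logisticProdDensity N y * (u ∘ P.map) y = 0 := by
      simp only [hF, mul_left_comm _ (logisticDensity t), integral_const_mul] at h0
      rw [mul_eq_zero, or_iff_right hft.ne'] at h0
      simpa only [mul_comm, Function.comp_apply] using h0
    rw [P.secondVariation_eq hv (hu1.differentiable (by simp))]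
    simp only [hF, hq, mul_assoc, integral_const_mul]
    have hpo := poincare_logisticProdDensity (P.contDiff_comp hu1) (P.hasCompactSupport_comp hs)
    rw [hmean] at hpo
    have hle := logisticDensity_le_of_le_abs ht
    have hnn : 0 ≤ ∫ y, logisticProdDensity N y * (u ∘ P.map) y ^ 2 :=
      integral_nonneg fun y => mul_nonneg (logisticProdDensity_pos y).le (sq_nonneg _)
    simp only [← mul_assoc, integral_mul_const]
    simp only [Function.comp_apply] at hpo hnn
    -- Poincaré gives Dirichlet energy at least 1/4 of the L² norm squared, and 2 f(t) ≤ 1/4.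
    nlinarith [mul_nonneg hft.le hnn, mul_nonneg (mul_nonneg hft.le hnn) (sub_nonneg.2 hle)]

end

section

/-! ### Stationary half-spaces that are not coordinate -/

variable {N : ℕ} {v : Euc (N + 1)} {t : ℝ}

lemma abs_eq_of_logisticDensity_eq {a b : ℝ} (h : logisticDensity a = logisticDensity b) :
    |a| = |b| := by
  simp only [logisticDensity_eq_slope] at h
  rw [abs_eq_abs]
  rcases sq_eq_sq_iff_eq_or_eq_neg.1 (by linarith : slope a ^ 2 = slope b ^ 2) with h | h
  · exact Or.inl (slope_strictMono.injective h)
  · exact Or.inr (slope_strictMono.injective (h.trans (slope_neg b).symm))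

lemma inner_single_add_single (i j : Fin (N + 1)) (a b : ℝ) :
    ⟪(EuclideanSpace.single i a + EuclideanSpace.single j b : Euc (N + 1)), v⟫_ℝ =
      a * v i + b * v j := by
  rw [inner_add_left, EuclideanSpace.inner_single_left, EuclideanSpace.inner_single_left]
  simp

/-- On the boundary of a stationary half-space all coordinates in the support of the normal have
the same absolute value. -/
lemma abs_eq_of_stationary (hv : ‖v‖ = 1)
    (hst : IsStationary (logisticProdDensity (N + 1)) (halfSpace v t)) {i j : Fin (N + 1)}
    (hi : v i ≠ 0) (hj : v j ≠ 0) {x : Euc (N + 1)} (hx : ⟪x, v⟫_ℝ = t) :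
    |x i| = |x j| := by
  obtain ⟨c, hc⟩ := (isStationary_halfSpace_iff hv).1 hst
  -- A tangent direction involving only coordinates i and j: the derivative of the stationarity
  -- equation along it is 2 v_i v_j (f(x_i) - f(x_j)).
  set w : Euc (N + 1) := EuclideanSpace.single i (v j) + EuclideanSpace.single j (-v i) with hw
  have hwv : ⟪w, v⟫_ℝ = 0 := by rw [hw, inner_single_add_single]; ring
  have hconst : ∀ s : ℝ, ∑ k, v k * slope (x k + s * w k) = c := fun s => by
    have := hc (x + s • w) (by rw [inner_add_left, real_inner_smul_left, hwv, hx]; ring)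
    simpa using this
  have hder : HasDerivAt (fun s : ℝ => ∑ k, v k * slope (x k + s * w k))
      (∑ k, v k * (2 * logisticDensity (x k + 0 * w k) * w k)) 0 := by
    refine HasDerivAt.fun_sum fun k _ => HasDerivAt.const_mul _ ?_
    have h1 : HasDerivAt (fun s : ℝ => x k + s * w k) (w k) 0 := by
      simpa using ((hasDerivAt_id' (0 : ℝ)).mul_const (w k)).const_add (x k)
    exact (hasDerivAt_slope _).comp 0 h1
  rw [funext hconst] at hder
  have h0 := hder.unique (hasDerivAt_const 0 c)
  have h1 : ∑ k, v k * (2 * logisticDensity (x k + 0 * w k) * w k) =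
      2 * v i * v j * (logisticDensity (x i) - logisticDensity (x j)) := by
    have e : ∀ k, v k * (2 * logisticDensity (x k + 0 * w k) * w k) =
        (if k = i then v k * (2 * logisticDensity (x k)) * v j else 0) +
          if k = j then v k * (2 * logisticDensity (x k)) * -v i else 0 := fun k => by
      simp only [hw, PiLp.add_apply, PiLp.single_apply]
      split_ifs <;> simp [mul_assoc]
      ring
    simp only [e, Finset.sum_add_distrib, Finset.sum_ite_eq', Finset.mem_univ, if_true]
    ring
  rw [h1] at h0
  apply abs_eq_of_logisticDensity_eq
  have : 2 * v i * v j ≠ 0 := by positivity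
  exact sub_eq_zero.1 ((mul_eq_zero.1 h0).resolve_left this)

/-- Each conclusion tests |x_i| = |x_j| at one boundary point. The point (t/v_j) e_j has x_i = 0 and
forces t = 0. For a third index k, v_k e_j - v_j e_k forces v_k = 0. Finally v_j e_i - v_i e_j
yields |v_i| = |v_j|. -/
lemma bisector_of_stationary (hv : ‖v‖ = 1) (hnc : ¬ IsCoordinate v)
    (hst : IsStationary (logisticProdDensity (N + 1)) (halfSpace v t)) :
    t = 0 ∧ v ∈ bisectorVectors (N + 1) := by
  obtain ⟨i, hi⟩ : ∃ i, v i ≠ 0 := by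
    by_contra! h
    have : v = 0 := by ext k; simp [h k]
    simp [this] at hv
  obtain ⟨j, hji, hj⟩ : ∃ j, j ≠ i ∧ v j ≠ 0 := by
    by_contra! h
    exact hnc ⟨i, h⟩
  have habs := fun (i j : Fin (N + 1)) => @abs_eq_of_stationary N v t hv hst i j
  have ht : t = 0 := by
    have := habs i j hi hj
      (x := EuclideanSpace.single i 0 + EuclideanSpace.single j (t / v j)) (by
        rw [inner_single_add_single]; field_simp; ring)
    simpa [hji, hji.symm, hj] using this.symm
  subst ht
  refine ⟨rfl, hv, i, j, hji.symm, fun k hki hkj => ?_, ?_, by simpa using hi⟩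
  · by_contra hk
    have := habs i j hi hj
      (x := EuclideanSpace.single j (v k) + EuclideanSpace.single k (-v j)) (by
        rw [inner_single_add_single]; ring)
    simp only [PiLp.add_apply, PiLp.single_apply, hki.symm, hkj.symm, hji.symm, if_false,
      if_true, add_zero, abs_zero] at this
    exact hk (abs_eq_zero.1 this.symm)
  · have := habs i j hi hj
      (x := EuclideanSpace.single i (v j) + EuclideanSpace.single j (-v i)) (by
        rw [inner_single_add_single]; ring)
    simpa [hji, hji.symm] using this.symm

/-! ### Bisector half-spaces -/

/-- The data of a bisector vector, with the second index written relative to the first. -/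
structure IsBisectorAt (v : Euc (N + 1)) (i : Fin (N + 1)) (m : Fin N) : Prop where
  apply_eq_zero : ∀ k, k ≠ m → v (i.succAbove k) = 0
  sq_fst : v i ^ 2 = 1 / 2
  sq_snd : v (i.succAbove m) ^ 2 = 1 / 2

lemma exists_isBisectorAt (hv : v ∈ bisectorVectors (N + 1)) : ∃ i m, IsBisectorAt v i m := by
  obtain ⟨hn, i, j, hij, h0, habs, -⟩ := hv
  obtain ⟨m, rfl⟩ := Fin.exists_succAbove_eq hij.symm
  have hk : ∀ k, k ≠ m → v (i.succAbove k) = 0 := fun k hk =>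
    h0 _ (Fin.succAbove_ne i k) fun h => hk (Fin.succAbove_right_injective h)
  have h := EuclideanSpace.real_norm_sq_eq v
  rw [hn, Fin.sum_univ_succAbove _ i, Finset.sum_eq_single m (fun k _ h => by simp [hk k h])
    (by simp)] at h
  have h2 := sq_eq_sq_iff_abs_eq_abs _ _ |>.2 habs
  exact ⟨i, m, hk, by linarith, by linarith⟩

namespace IsBisectorAt

variable {i : Fin (N + 1)} {m : Fin N}

lemma inner_eq (h : IsBisectorAt v i m) (x : Euc (N + 1)) :
    ⟪x, v⟫_ℝ = x i * v i + x (i.succAbove m) * v (i.succAbove m) := by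
  rw [PiLp.inner_apply, Fin.sum_univ_succAbove _ i,
    Finset.sum_eq_single m (fun k _ hk => by simp [h.apply_eq_zero k hk]) (by simp)]
  simp [mul_comm]

/-- The parametrization of the boundary of a bisector half-space through the origin. -/
def param (h : IsBisectorAt v i m) : BoundaryParam v 0 where
  lin := graphIsometry i (-v (i.succAbove m) • (EuclideanSpace.proj m : Euc N →L[ℝ] ℝ).toLinearMap)
    (Function.update 1 m (v i)) fun y => by
      rw [← Finset.add_sum_erase _ _ (Finset.mem_univ m),
        ← Finset.add_sum_erase _ (fun k => y k ^ 2) (Finset.mem_univ m), ← add_assoc]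
      congr 1
      · simp [mul_pow, h.sq_fst, h.sq_snd]; ring
      · refine Finset.sum_congr rfl fun k hk => ?_
        simp [Function.update_of_ne (Finset.ne_of_mem_erase hk)]
  base := 0
  range_eq := by
    ext x
    rw [mem_range, mem_ofPred_eq, h.inner_eq]
    constructor
    · rintro ⟨y, rfl⟩
      simp [graphIsometry_apply_same, graphIsometry_apply_succAbove]
      ring
    · intro hx
      -- The chart sends y_m to v_i y_m in the second bisector coordinate; the inverse factor is
      -- 1/v_i = 2 v_i because v_i² = 1/2.
      refine ⟨WithLp.toLp 2 (Function.update (fun k => x (i.succAbove k)) m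
        (2 * v i * x (i.succAbove m))), ?_⟩
      ext k
      revert k
      rw [Fin.forall_iff_succAbove i]
      constructor
      · simp only [zero_add, graphIsometry_apply_same]
        simp
        linear_combination (-2 * v i) * hx + 2 * x i * h.sq_fst
      · intro k
        simp only [zero_add, graphIsometry_apply_succAbove]
        by_cases hk : k = m
        · subst hk
          simp
          linear_combination 2 * x (i.succAbove k) * h.sq_fst
        · simp [Function.update_of_ne hk]

lemma param_map_fst (h : IsBisectorAt v i m) (y : Euc N) :
    h.param.map y i = -v (i.succAbove m) * y m := by
  simp [param, BoundaryParam.map, graphIsometry_apply_same]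

lemma param_map_snd (h : IsBisectorAt v i m) (y : Euc N) :
    h.param.map y (i.succAbove m) = v i * y m := by
  simp [param, BoundaryParam.map, graphIsometry_apply_succAbove]

lemma param_map_of_ne (h : IsBisectorAt v i m) (y : Euc N) {k : Fin N} (hk : k ≠ m) :
    h.param.map y (i.succAbove k) = y k := by
  simp [param, BoundaryParam.map, graphIsometry_apply_succAbove, Function.update_of_ne hk]

lemma param_map_neg (h : IsBisectorAt v i m) (y : Euc N) : h.param.map (-y) = -h.param.map y := by
  simp [param, BoundaryParam.map]

lemma logisticDensity_map_fst (h : IsBisectorAt v i m) (y : Euc N) :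
    logisticDensity (h.param.map y i) = logisticDensity (v i * y m) := by
  rw [h.param_map_fst]
  rcases sq_eq_sq_iff_eq_or_eq_neg.1 (h.sq_snd.trans h.sq_fst.symm) with e | e
  · rw [e, neg_mul, logisticDensity_neg]
  · rw [e, neg_neg]

lemma density_map (h : IsBisectorAt v i m) (y : Euc N) :
    logisticProdDensity (N + 1) (h.param.map y) =
      logisticDensity (v i * y m) ^ 2 * ∏ k ∈ Finset.univ.erase m, logisticDensity (y k) := by
  rw [logisticProdDensity, Fin.prod_univ_succAbove _ i, h.logisticDensity_map_fst,
    ← Finset.mul_prod_erase _ _ (Finset.mem_univ m), h.param_map_snd, ← mul_assoc, ← sq]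
  congr 1
  exact Finset.prod_congr rfl fun k hk => by rw [h.param_map_of_ne _ (Finset.ne_of_mem_erase hk)]

/-- The two active coordinates are equal up to sign and f is even, so the weights 1/2 + 1/2 give f
with coefficient one. -/
lemma sum_sq_mul_density_map (h : IsBisectorAt v i m) (y : Euc N) :
    ∑ k, v k ^ 2 * logisticDensity (h.param.map y k) = logisticDensity (v i * y m) := by
  rw [Fin.sum_univ_succAbove _ i,
    Finset.sum_eq_single m (fun k _ hk => by simp [h.apply_eq_zero k hk]) (by simp),
    h.logisticDensity_map_fst, h.param_map_snd, h.sq_fst, h.sq_snd]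
  ring

lemma fst_ne_zero (h : IsBisectorAt v i m) : v i ≠ 0 := fun h0 => by
  have := h.sq_fst
  rw [h0] at this
  norm_num at this

end IsBisectorAt

lemma isStationary_of_isBisectorAt (hv : ‖v‖ = 1) {i : Fin (N + 1)} {m : Fin N}
    (h : IsBisectorAt v i m) : IsStationary (logisticProdDensity (N + 1)) (halfSpace v 0) := by
  refine (isStationary_halfSpace_iff hv).2 ⟨0, fun x hx => ?_⟩
  rw [h.inner_eq] at hx
  rw [Fin.sum_univ_succAbove _ i,
    Finset.sum_eq_single m (fun k _ hk => by simp [h.apply_eq_zero k hk]) (by simp)]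
  have h0 := h.fst_ne_zero
  rcases sq_eq_sq_iff_eq_or_eq_neg.1 (h.sq_snd.trans h.sq_fst.symm) with e | e
  · rw [e, ← add_mul] at hx
    have : x i = -x (i.succAbove m) := by
      linarith [(mul_eq_zero.1 hx).resolve_right h0]
    rw [e, this, slope_neg]; ring
  · rw [e, mul_neg, ← sub_eq_add_neg, ← sub_mul] at hx
    have : x i = x (i.succAbove m) := by
      linarith [(mul_eq_zero.1 hx).resolve_right h0]
    rw [e, this]; ring

lemma integral_euc_one (G : Euc 1 → ℝ) :
    ∫ y, G y = ∫ s : ℝ, G (WithLp.toLp 2 fun _ => s) := by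
  rw [integral_euc]
  exact (((volume_preserving_funUnique (Fin 1) ℝ).symm).integral_comp'
    (fun x => G (WithLp.toLp 2 x))).symm

/-- In the plane, half-planes bounded by a bisector of the axes are stable. -/
lemma isStable_of_bisector {v : Euc (1 + 1)} (hv : v ∈ bisectorVectors (1 + 1)) :
    IsStable (logisticProdDensity (1 + 1)) (halfSpace v 0) := by
  obtain ⟨i, m, h⟩ := exists_isBisectorAt hv
  have hn := hv.1
  refine ⟨isStationary_of_isBisectorAt hn h, fun u hu hs h0 => ?_⟩
  have hm : m = 0 := Subsingleton.elim _ _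
  subst hm
  set κ := v i with hκ
  have hκ0 : κ ≠ 0 := h.fst_ne_zero
  have hu1 : ContDiff ℝ 1 u := hu.of_le (by exact_mod_cast le_top)
  set w := u ∘ h.param.map with hw
  have hw1 : ContDiff ℝ 1 w := h.param.contDiff_comp hu1
  have hws : HasCompactSupport w := h.param.hasCompactSupport_comp hs
  have hF : ∀ y, logisticProdDensity (1 + 1) (h.param.map y) = logisticDensity (κ * y 0) ^ 2 :=
    fun y => by rw [h.density_map, ← hκ]; simp
  set line : ℝ → Euc 1 := fun s => WithLp.toLp 2 fun _ => s with hline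
  have hlc : Continuous line := (PiLp.continuous_toLp 2 _).comp (continuous_pi fun _ => continuous_id)
  have hl : ∀ s, HasDerivAt line (EuclideanSpace.single 0 1) s := fun s => by
    have e : line = fun s => s • (EuclideanSpace.single 0 1 : Euc 1) := by
      ext s k
      simp [hline, Subsingleton.elim k 0]
    rw [e]
    simpa using (hasDerivAt_id' s).smul_const (EuclideanSpace.single 0 1 : Euc 1)
  have hle : IsClosedEmbedding line :=
    Function.LeftInverse.isClosedEmbedding (f := fun y : Euc 1 => y 0) (fun s => rfl)
      (by fun_prop) hlc
  set w' : Euc 1 → ℝ := fun y => fderiv ℝ w y (EuclideanSpace.single 0 1) with hw'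
  have hw'c : Continuous w' := (hw1.continuous_fderiv (by simp)).clm_apply continuous_const
  have hw's : HasCompactSupport w' :=
    (hws.fderiv (𝕜 := ℝ)).comp_left (g := fun L : Euc 1 →L[ℝ] ℝ => L (EuclideanSpace.single 0 1))
      (by simp)
  set σ : ℝ ≃ₜ ℝ := Homeomorph.mulLeft₀ κ⁻¹ (inv_ne_zero hκ0) with hσ
  have hσa : ∀ x, σ x = κ⁻¹ * x := fun x => rfl
  have hσκ : ∀ s, σ (κ * s) = s := fun s => by rw [hσa, inv_mul_cancel_left₀ hκ0]
  have scale : ∀ G : ℝ → ℝ, ∫ s, G (κ * s) = |κ⁻¹| * ∫ x, G x := fun G =>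
    Measure.integral_comp_mul_left G κ
  -- The substitution x = κs removes the scale from the density. The Dirichlet term picks up κ² =
  -- 1/2, which turns the constant 4 into the coefficient 2 of the potential term.
  have key := bisector_inequality (u := fun x => w (line (σ x)))
    (u' := fun x => κ⁻¹ * w' (line (σ x))) (fun x => by
      have h1 : HasDerivAt σ κ⁻¹ x := by
        simpa [hσa] using! (hasDerivAt_id' x).const_mul κ⁻¹
      have h2 := ((hw1.differentiable (by simp) (line (σ x))).hasFDerivAt.comp_hasDerivAt (σ x)
        (hl (σ x))).scomp x h1
      exact h2) (by fun_prop)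
    ((hws.comp_isClosedEmbedding hle).comp_homeomorph σ)
    ((((hw's.comp_isClosedEmbedding hle).comp_homeomorph σ)).mul_left) (by
      rw [h.param.integral_area hn, integral_euc_one] at h0
      have := scale fun x => logisticDensity x ^ 2 * w (line (σ x))
      simp only [hσκ] at this
      have h3 : |κ⁻¹| * ∫ x, logisticDensity x ^ 2 * w (line (σ x)) = 0 := by
        rw [← this, ← h0]
        refine integral_congr_ae (ae_of_all _ fun s => ?_)
        simp only [hF, hw, Function.comp_apply]
        rw [mul_comm]
      exact (mul_eq_zero.1 h3).resolve_left (by positivity))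
  rw [h.param.secondVariation_eq hn (hu1.differentiable (by simp)), integral_euc_one,
    integral_euc_one]
  have e1 : ∫ s : ℝ, logisticProdDensity (1 + 1) (h.param.map (line s)) *
      ‖gradient w (line s)‖ ^ 2 =
      |κ⁻¹| * (κ ^ 2 * ∫ x, logisticDensity x ^ 2 * (κ⁻¹ * w' (line (σ x))) ^ 2) := by
    rw [← integral_const_mul, ← scale]
    refine integral_congr_ae (ae_of_all _ fun s => ?_)
    simp only [hF, hσκ, norm_gradient_sq, Finset.univ_unique, Finset.sum_singleton]
    field_simp
    rfl
  have e2 : ∫ s : ℝ, logisticProdDensity (1 + 1) (h.param.map (line s)) *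
      (u (h.param.map (line s)) ^ 2 *
        ∑ k, v k ^ 2 * logisticDensity (h.param.map (line s) k)) =
      |κ⁻¹| * ∫ x, logisticDensity x ^ 3 * w (line (σ x)) ^ 2 := by
    rw [← scale]
    refine integral_congr_ae (ae_of_all _ fun s => ?_)
    simp only [hF, hσκ, h.sum_sq_mul_density_map, hw, Function.comp_apply, ← hκ]
    have : (line s) 0 = s := rfl
    rw [this]
    ring
  rw [e1, e2, h.sq_fst]
  have := mul_le_mul_of_nonneg_left key (abs_nonneg κ⁻¹)
  linarith

end

section

/-! ### Instability of bisector half-spaces in dimension at least three -/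

variable {N : ℕ} {v : Euc (N + 1)}

/-- An odd bounded function with a small Rayleigh quotient for the logistic measure. -/
def oddTest (x : ℝ) : ℝ := slope x + slope x ^ 3

/-- The derivative of `oddTest`. -/
def oddTestDeriv (x : ℝ) : ℝ := 2 * logisticDensity x * (1 + 3 * slope x ^ 2)

lemma hasDerivAt_oddTest (x : ℝ) : HasDerivAt oddTest (oddTestDeriv x) x := by
  refine ((hasDerivAt_slope x).fun_add ((hasDerivAt_slope x).fun_pow 3)).congr_deriv ?_
  rw [oddTestDeriv]; push_cast; ring

lemma oddTest_neg (x : ℝ) : oddTest (-x) = -oddTest x := by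
  rw [oddTest, oddTest, slope_neg]; ring

lemma abs_oddTest_le (x : ℝ) : |oddTest x| ≤ 2 := by
  have h := abs_slope_le x
  calc |oddTest x| ≤ |slope x| + |slope x ^ 3| := abs_add_le _ _
    _ ≤ 1 + 1 := by
      rw [abs_pow]; exact add_le_add h (pow_le_one₀ (abs_nonneg _) h)
    _ = 2 := by norm_num

lemma abs_oddTestDeriv_le (x : ℝ) : |oddTestDeriv x| ≤ 2 := by
  have h0 := logisticDensity_pos x
  have h1 := logisticDensity_le x
  have h2 : slope x ^ 2 ≤ 1 := (sq_le_one_iff_abs_le_one _).2 (abs_slope_le x)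
  have h3 := sq_nonneg (slope x)
  rw [oddTestDeriv, abs_of_nonneg (by positivity)]
  nlinarith

lemma contDiff_oddTest {n : ℕ∞} : ContDiff ℝ n oddTest :=
  contDiff_slope.add (contDiff_slope.pow 3)

/-- Under the logistic measure `slope` is uniform on [-1, 1], so integrals of polynomials in `slope`
are elementary. -/
lemma integral_logisticDensity_mul_comp_slope {G H : ℝ → ℝ} (hG : Continuous G)
    (hH : ∀ s, HasDerivAt H (G s) s) :
    ∫ x, logisticDensity x * G (slope x) = (H 1 - H (-1)) / 2 := by
  have h := integral_logisticDensity_mul_comp_sigmoid fun y => G (2 * y - 1)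
  have hd : ∀ y ∈ uIcc (0 : ℝ) 1, HasDerivAt (fun y => H (2 * y - 1) / 2) (G (2 * y - 1)) y :=
    fun y _ => by
      have h1 : HasDerivAt (fun y : ℝ => 2 * y - 1) 2 y := by
        simpa using ((hasDerivAt_id' y).const_mul 2).sub_const 1
      refine (((hH _).comp y h1).div_const 2).congr_deriv ?_
      ring
  rw [intervalIntegral.integral_eq_sub_of_hasDerivAt hd
    ((by fun_prop : Continuous fun y => G (2 * y - 1)).intervalIntegrable _ _)] at h
  refine h.trans ?_
  norm_num
  ring

lemma integral_oddTest_sq : ∫ x, logisticDensity x * oddTest x ^ 2 = 92 / 105 := by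
  have h := integral_logisticDensity_mul_comp_slope
    (G := fun s => (s + s ^ 3) ^ 2) (H := fun s => s ^ 3 / 3 + 2 / 5 * s ^ 5 + s ^ 7 / 7)
    (by fun_prop) fun s => by
      refine ((((hasDerivAt_pow 3 s).div_const 3).fun_add
        ((hasDerivAt_pow 5 s).const_mul (2 / 5))).fun_add
        ((hasDerivAt_pow 7 s).div_const 7)).congr_deriv ?_
      push_cast; ring
  refine h.trans ?_
  norm_num

/-- Instability needs a Rayleigh quotient below 2/5. The function `slope` alone gives (2/15)/(1/3) =
2/5 exactly; the cubic correction lowers the quotient to 32/92 = 8/23. -/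
lemma integral_oddTestDeriv_sq : ∫ x, logisticDensity x * oddTestDeriv x ^ 2 = 32 / 105 := by
  have h := integral_logisticDensity_mul_comp_slope
    (G := fun s => (2 * ((1 - s ^ 2) / 4) * (1 + 3 * s ^ 2)) ^ 2)
    (H := fun s => s / 4 + s ^ 3 / 3 + -1 / 10 * s ^ 5 + -3 / 7 * s ^ 7 + s ^ 9 / 4)
    (by fun_prop) fun s => by
      refine ((((((hasDerivAt_id' s).div_const 4).fun_add
        ((hasDerivAt_pow 3 s).div_const 3)).fun_add
        ((hasDerivAt_pow 5 s).const_mul (-1 / 10))).fun_add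
        ((hasDerivAt_pow 7 s).const_mul (-3 / 7))).fun_add
        ((hasDerivAt_pow 9 s).div_const 4)).congr_deriv ?_
      push_cast; ring
  simp only [← logisticDensity_eq_slope] at h
  refine h.trans ?_
  norm_num

/-- Two-coordinate functions, completed to products by the logistic density. -/
def twoFactor (m k : Fin N) (A B : ℝ → ℝ) (y : Euc N) : ℝ :=
  A (y m) * (B (y k) * ∏ l ∈ (Finset.univ.erase m).erase k, logisticDensity (y l))

lemma twoFactor_eq_prod {m k : Fin N} (hmk : k ≠ m) (A B : ℝ → ℝ) (x : Fin N → ℝ) :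
    twoFactor m k A B (WithLp.toLp 2 x) = ∏ l, (Function.update
      (Function.update (fun _ => logisticDensity) k B) m A : Fin N → ℝ → ℝ) l (x l) := by
  rw [← Finset.mul_prod_erase _ _ (Finset.mem_univ m),
    ← Finset.mul_prod_erase _ _ (Finset.mem_erase.2 ⟨hmk, Finset.mem_univ k⟩), twoFactor]
  simp only [Function.update_self, Function.update_of_ne hmk]
  congr 2
  refine Finset.prod_congr rfl fun l hl => ?_
  rw [Finset.mem_erase, Finset.mem_erase] at hl
  rw [Function.update_of_ne hl.2.1, Function.update_of_ne hl.1]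

lemma integral_twoFactor {m k : Fin N} (hmk : k ≠ m) (A B : ℝ → ℝ) :
    ∫ y, twoFactor m k A B y = (∫ s, A s) * ∫ s, B s := by
  rw [integral_euc]
  simp only [twoFactor_eq_prod hmk]
  rw [integral_fintype_prod_volume_eq_prod (f := (Function.update
      (Function.update (fun _ => logisticDensity) k B) m A : Fin N → ℝ → ℝ)),
    ← Finset.mul_prod_erase _ _ (Finset.mem_univ m),
    ← Finset.mul_prod_erase _ _ (Finset.mem_erase.2 ⟨hmk, Finset.mem_univ k⟩)]
  simp only [Function.update_self, Function.update_of_ne hmk]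
  rw [Finset.prod_eq_one, mul_one]
  intro l hl
  rw [Finset.mem_erase, Finset.mem_erase] at hl
  rw [Function.update_of_ne hl.2.1, Function.update_of_ne hl.1, integral_logisticDensity]

lemma integrable_twoFactor {m k : Fin N} (hmk : k ≠ m) {A B : ℝ → ℝ} (hA : Integrable A)
    (hB : Integrable B) : Integrable (twoFactor m k A B) := by
  rw [← (PiLp.volume_preserving_toLp (Fin N)).integrable_comp_emb
    (MeasurableEquiv.toLp 2 (Fin N → ℝ)).measurableEmbedding]
  have : (twoFactor m k A B ∘ WithLp.toLp 2) = fun x => ∏ l, (Function.update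
      (Function.update (fun _ => logisticDensity) k B) m A : Fin N → ℝ → ℝ) l (x l) :=
    funext (twoFactor_eq_prod hmk A B)
  rw [this]
  refine Integrable.fintype_prod fun l => ?_
  by_cases hl : l = m
  · subst hl; simpa using hA
  by_cases hl' : l = k
  · subst hl'; simpa [hl] using hB
  · simpa [hl, hl'] using integrable_logisticDensity

lemma norm_gradient {n : ℕ} (w : Euc n → ℝ) (y : Euc n) : ‖gradient w y‖ = ‖fderiv ℝ w y‖ :=
  LinearIsometryEquiv.norm_map _ _

lemma norm_gradient_comp_apply_sq {k : Fin N} {g : ℝ → ℝ} {g' : ℝ} {y : Euc N}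
    (hg : HasDerivAt g g' (y k)) : ‖gradient (fun y : Euc N => g (y k)) y‖ ^ 2 = g' ^ 2 := by
  have h : HasFDerivAt (fun y : Euc N => g (y k))
      (g' • (EuclideanSpace.proj k : Euc N →L[ℝ] ℝ)) y :=
    HasDerivAt.comp_hasFDerivAt (f := fun y : Euc N => y k) y hg (hasFDerivAt_apply_euc k y)
  rw [norm_gradient_sq, h.fderiv, Finset.sum_eq_single k]
  · simp
  · intro l _ hl
    simp [hl.symm]
  · simp

/-! ### Truncation of the odd test function -/

/-- The smooth cutoff used for the test functions. -/
def cutoff (d : ℕ) : ContDiffBump (0 : Euc d) := ⟨1, 2, by norm_num, by norm_num⟩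

/-- The truncated test functions. -/
def truncTest {d : ℕ} (k : Fin d) (n : ℕ) (x : Euc d) : ℝ :=
  oddTest (x k) * cutoff d (((n : ℝ) + 1)⁻¹ • x)

lemma contDiff_truncTest {d : ℕ} (k : Fin d) (n : ℕ) : ContDiff ℝ ∞ (truncTest k n) := by
  refine ContDiff.mul (contDiff_oddTest.comp ?_) ((cutoff d).contDiff.comp (by fun_prop))
  exact (EuclideanSpace.proj k : Euc d →L[ℝ] ℝ).contDiff

lemma hasCompactSupport_truncTest {d : ℕ} (k : Fin d) (n : ℕ) :
    HasCompactSupport (truncTest k n) :=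
  ((cutoff d).hasCompactSupport.comp_smul (c := ((n : ℝ) + 1)⁻¹) (by positivity)).mul_left

lemma truncTest_neg {d : ℕ} (k : Fin d) (n : ℕ) (x : Euc d) :
    truncTest k n (-x) = -truncTest k n x := by
  simp only [truncTest, PiLp.neg_apply, oddTest_neg, smul_neg, ContDiffBump.neg, neg_mul]

lemma abs_truncTest_le {d : ℕ} (k : Fin d) (n : ℕ) (x : Euc d) : |truncTest k n x| ≤ 2 := by
  rw [truncTest, abs_mul, abs_of_nonneg (ContDiffBump.nonneg _)]
  exact (mul_le_mul (abs_oddTest_le _) (ContDiffBump.le_one _) (ContDiffBump.nonneg _)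
    (by norm_num)).trans (by norm_num)

/-- Uniformity in n supplies the dominating function for the Dirichlet terms. It holds because the
dilation factor 1/(n+1) is at most one and `oddTest` and its derivative are bounded. -/
lemma exists_norm_fderiv_truncTest_le {d : ℕ} (k : Fin d) :
    ∃ K : ℝ, ∀ n x, ‖fderiv ℝ (truncTest k n) x‖ ≤ K := by
  have hχ : ContDiff ℝ 1 (cutoff d) := (cutoff d).contDiff
  obtain ⟨D, hD⟩ := ((cutoff d).hasCompactSupport.fderiv (𝕜 := ℝ)).exists_bound_of_continuous
    (hχ.continuous_fderiv (by simp))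
  have hD0 : 0 ≤ D := (norm_nonneg _).trans (hD 0)
  refine ⟨2 * D + 2 * ‖(EuclideanSpace.proj k : Euc d →L[ℝ] ℝ)‖, fun n x => ?_⟩
  set c : ℝ := ((n : ℝ) + 1)⁻¹ with hc
  have hc0 : 0 ≤ c := by positivity
  have hc1 : c ≤ 1 := inv_le_one_of_one_le₀ (by linarith [n.cast_nonneg (α := ℝ)])
  have h1 : HasFDerivAt (fun x : Euc d => oddTest (x k))
      (oddTestDeriv (x k) • (EuclideanSpace.proj k : Euc d →L[ℝ] ℝ)) x :=
    HasDerivAt.comp_hasFDerivAt (f := fun y : Euc d => y k) x (hasDerivAt_oddTest (x k))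
      (hasFDerivAt_apply_euc k x)
  have h2 : HasFDerivAt (fun x : Euc d => cutoff d (c • x))
      ((fderiv ℝ (cutoff d) (c • x)).comp (c • ContinuousLinearMap.id ℝ (Euc d))) x :=
    (hχ.differentiable (by simp) (c • x)).hasFDerivAt.comp x ((hasFDerivAt_id x).const_smul c)
  have h3 : fderiv ℝ (truncTest k n) x = _ := (h1.mul h2).fderiv
  rw [h3]
  refine (norm_add_le _ _).trans (add_le_add ?_ ?_)
  · rw [norm_smul]
    refine mul_le_mul (abs_oddTest_le _) ?_ (norm_nonneg _) (by norm_num)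
    refine (ContinuousLinearMap.opNorm_comp_le _ _).trans ?_
    have h4 : ‖c • ContinuousLinearMap.id ℝ (Euc d)‖ ≤ 1 := by
      rw [norm_smul, Real.norm_of_nonneg hc0]
      exact mul_le_one₀ hc1 (norm_nonneg _) ContinuousLinearMap.norm_id_le
    exact (mul_le_mul (hD _) h4 (norm_nonneg _) hD0).trans (mul_one D).le
  · rw [norm_smul, norm_smul, Real.norm_of_nonneg (ContDiffBump.nonneg _)]
    refine (mul_le_of_le_one_left (by positivity) (ContDiffBump.le_one _)).trans ?_
    exact mul_le_mul_of_nonneg_right (abs_oddTestDeriv_le _) (norm_nonneg _)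

/-- Agreement on a neighbourhood, not just at the point, makes the gradients converge pointwise as
well. -/
lemma eventually_truncTest_eq {d : ℕ} (k : Fin d) (x : Euc d) :
    ∀ᶠ n : ℕ in atTop, truncTest k n =ᶠ[𝓝 x] fun x => oddTest (x k) := by
  have hlim : Tendsto (fun n : ℕ => ((n : ℝ) + 1)⁻¹ • x) atTop (𝓝 0) := by
    have := (tendsto_one_div_add_atTop_nhds_zero_nat (𝕜 := ℝ)).smul_const x
    simpa using this
  filter_upwards [hlim (Metric.ball_mem_nhds 0 one_pos)] with n hn
  have h1 : cutoff d =ᶠ[𝓝 (((n : ℝ) + 1)⁻¹ • x)] 1 := (cutoff d).eventuallyEq_one_of_mem_ball hn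
  have h2 : Tendsto (fun x : Euc d => ((n : ℝ) + 1)⁻¹ • x) (𝓝 x) (𝓝 (((n : ℝ) + 1)⁻¹ • x)) :=
    (continuous_const_smul _).tendsto x
  filter_upwards [h2.eventually h1] with z hz
  rw [truncTest, hz, Pi.one_apply, mul_one]

lemma logisticProdDensity_neg {d : ℕ} (x : Euc d) :
    logisticProdDensity d (-x) = logisticProdDensity d x := by
  simp [logisticProdDensity, logisticDensity_neg]

/-- In dimension at least three, half-spaces bounded by a bisector hyperplane are not stable. -/
lemma not_isStable_of_isBisectorAt (hv : ‖v‖ = 1) {i : Fin (N + 1)} {m k : Fin N}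
    (h : IsBisectorAt v i m) (hk : k ≠ m) :
    ¬ IsStable (logisticProdDensity (N + 1)) (halfSpace v 0) := by
  intro hst
  set P := h.param with hP
  set κ := v i with hκ
  have hκ0 : κ ≠ 0 := h.fst_ne_zero
  set u : ℕ → Euc (N + 1) → ℝ := truncTest (i.succAbove k) with hu
  have hu1 : ∀ n, ContDiff ℝ 1 (u n) := fun n =>
    (contDiff_truncTest _ n).of_le (by exact_mod_cast le_top)
  have hscale : ∀ G : ℝ → ℝ, ∫ s, G (κ * s) = |κ⁻¹| * ∫ x, G x := fun G =>
    Measure.integral_comp_mul_left G κ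
  have hF : ∀ y, logisticProdDensity (N + 1) (P.map y) =
      twoFactor m k (fun s => logisticDensity (κ * s) ^ 2) logisticDensity y := fun y => by
    rw [hP, h.density_map, twoFactor,
      ← Finset.mul_prod_erase _ _ (Finset.mem_erase.2 ⟨hk, Finset.mem_univ k⟩)]
  have hFi : Integrable fun y => logisticProdDensity (N + 1) (P.map y) := by
    simp only [hF]
    exact integrable_twoFactor hk
      ((integrable_comp_mul_left_iff (fun s => logisticDensity s ^ 2) hκ0).2
        integrable_logisticDensity_sq) integrable_logisticDensity
  have hFc : Continuous fun y => logisticProdDensity (N + 1) (P.map y) :=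
    (continuous_logisticProdDensity _).comp P.isometry.continuous
  have hnonneg : ∀ n, 0 ≤ secondVariation (logisticProdDensity (N + 1)) (halfSpace v 0) (u n) := by
    intro n
    refine hst.2 _ (contDiff_truncTest _ n) (hasCompactSupport_truncTest _ n) ?_
    rw [P.integral_area hv]
    -- The hyperplane passes through the origin, the density is even and the truncated test function
    -- is odd, so its mean vanishes without any correction.
    have h1 := integral_neg_eq_self
      (fun y => u n (P.map y) * logisticProdDensity (N + 1) (P.map y)) volume
    simp only [hP, h.param_map_neg, hu, truncTest_neg, logisticProdDensity_neg, neg_mul,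
      integral_neg] at h1 ⊢
    linarith
  have hq : ∀ y, ∑ k, v k ^ 2 * logisticDensity (P.map y k) = logisticDensity (κ * y m) :=
    h.sum_sq_mul_density_map
  obtain ⟨K, hK⟩ := exists_norm_fderiv_truncTest_le (i.succAbove k)
  have hK0 : 0 ≤ K := (norm_nonneg _).trans (hK 0 0)
  have hgrad : ∀ n y, ‖gradient (u n ∘ P.map) y‖ ≤ K := fun n y => by
    have h1 : fderiv ℝ (u n ∘ P.map) y = _ :=
      (((hu1 n).differentiable (by simp) (P.map y)).hasFDerivAt.comp y
        (P.hasFDerivAt_map y)).fderiv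
    rw [norm_gradient, h1]
    refine (ContinuousLinearMap.opNorm_comp_le _ _).trans ?_
    exact (mul_le_mul (hK n _) P.lin.norm_toContinuousLinearMap_le (norm_nonneg _) hK0).trans
      (mul_one K).le
  have hev : ∀ y, ∀ᶠ n in atTop, (u n ∘ P.map) =ᶠ[𝓝 y] fun y => oddTest (y k) := fun y => by
    filter_upwards [eventually_truncTest_eq (i.succAbove k) (P.map y)] with n hn
    filter_upwards [(P.isometry.continuous.tendsto y).eventually hn] with z hz
    rw [Function.comp_apply, hu, hz, hP, h.param_map_of_ne _ hk]
  have lim1 : Tendsto (fun n => ∫ y, logisticProdDensity (N + 1) (P.map y) *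
      ‖gradient (u n ∘ P.map) y‖ ^ 2) atTop
      (𝓝 (∫ y, logisticProdDensity (N + 1) (P.map y) * oddTestDeriv (y k) ^ 2)) := by
    refine tendsto_integral_of_dominated_convergence
      (fun y => logisticProdDensity (N + 1) (P.map y) * K ^ 2) (fun n => ?_) (hFi.mul_const _)
      (fun n => ae_of_all _ fun y => ?_) (ae_of_all _ fun y => ?_)
    · simp only [norm_gradient]
      exact (hFc.mul (((P.contDiff_comp (hu1 n)).continuous_fderiv
        (by simp)).norm.pow 2)).aestronglyMeasurable
    · rw [Real.norm_of_nonneg (mul_nonneg (logisticProdDensity_pos _).le (sq_nonneg _))]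
      exact mul_le_mul_of_nonneg_left (pow_le_pow_left₀ (norm_nonneg _) (hgrad n y) 2)
        (logisticProdDensity_pos _).le
    · refine tendsto_const_nhds.congr' ?_
      filter_upwards [hev y] with n hn
      rw [← norm_gradient_comp_apply_sq (hasDerivAt_oddTest (y k)), gradient, gradient,
        hn.fderiv_eq]
  have lim2 : Tendsto (fun n => ∫ y, logisticProdDensity (N + 1) (P.map y) *
      (u n (P.map y) ^ 2 * ∑ k, v k ^ 2 * logisticDensity (P.map y k))) atTop
      (𝓝 (∫ y, logisticProdDensity (N + 1) (P.map y) *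
        (oddTest (y k) ^ 2 * logisticDensity (κ * y m)))) := by
    simp only [hq]
    refine tendsto_integral_of_dominated_convergence
      (fun y => logisticProdDensity (N + 1) (P.map y) * (2 ^ 2 * (1 / 4))) (fun n => ?_)
      (hFi.mul_const _) (fun n => ae_of_all _ fun y => ?_) (ae_of_all _ fun y => ?_)
    · refine (hFc.mul ((((hu1 n).continuous.comp P.isometry.continuous).pow 2).mul
        (continuous_logisticDensity.comp (by fun_prop)))).aestronglyMeasurable
    · rw [norm_mul, norm_mul, Real.norm_of_nonneg (logisticProdDensity_pos _).le, norm_pow]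
      refine mul_le_mul_of_nonneg_left ?_ (logisticProdDensity_pos _).le
      exact mul_le_mul (pow_le_pow_left₀ (norm_nonneg _) (abs_truncTest_le _ _ _) 2)
        (abs_logisticDensity_le _) (norm_nonneg _) (by norm_num)
    · refine tendsto_const_nhds.congr' ?_
      filter_upwards [hev y] with n hn
      have : u n (P.map y) = oddTest (y k) := hn.self_of_nhds
      rw [this]
  have hlim := ge_of_tendsto' (lim1.sub (lim2.const_mul 2)) fun n => by
    rw [← P.secondVariation_eq hv ((hu1 n).differentiable (by simp))]
    exact hnonneg n
  have e1 : ∫ y, logisticProdDensity (N + 1) (P.map y) * oddTestDeriv (y k) ^ 2 =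
      |κ⁻¹| * (1 / 6) * (32 / 105) := by
    rw [← integral_oddTestDeriv_sq, ← integral_logisticDensity_sq,
      ← hscale (fun s => logisticDensity s ^ 2), ← integral_twoFactor hk]
    refine integral_congr_ae (ae_of_all _ fun y => ?_)
    simp only [hF, twoFactor]
    ring
  have e2 : ∫ y, logisticProdDensity (N + 1) (P.map y) *
      (oddTest (y k) ^ 2 * logisticDensity (κ * y m)) = |κ⁻¹| * (1 / 30) * (92 / 105) := by
    rw [← integral_oddTest_sq, ← integral_logisticDensity_cube,
      ← hscale (fun s => logisticDensity s ^ 3), ← integral_twoFactor hk]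
    refine integral_congr_ae (ae_of_all _ fun y => ?_)
    simp only [hF, twoFactor]
    ring
  -- The limit of the second variations is |κ⁻¹| times (1/6)(32/105) - 2(1/30)(92/105) = -4/525,
  -- contradicting nonnegativity.
  rw [e1, e2] at hlim
  have hpos : 0 < |κ⁻¹| := by positivity
  linarith

end

end HalfSpaceStability

end

theorem mainTheorem8 (N : ℕ) (v : HalfSpaceStability.Euc (N + 1)) (hv : ‖v‖ = 1) (t : ℝ) :
    (HalfSpaceStability.IsCoordinate v → 2 * Real.log (2 + √3) ≤ |t| →
      HalfSpaceStability.IsStable (HalfSpaceStability.logisticProdDensity (N + 1))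
        (HalfSpaceStability.halfSpace v t)) ∧
    (¬ HalfSpaceStability.IsCoordinate v →
      (HalfSpaceStability.IsStable (HalfSpaceStability.logisticProdDensity (N + 1))
          (HalfSpaceStability.halfSpace v t) ↔
        N + 1 = 2 ∧ t = 0 ∧ v ∈ HalfSpaceStability.bisectorVectors (N + 1))) := by
  refine ⟨HalfSpaceStability.isStable_of_coordinate hv, fun hnc => ⟨fun hst => ?_, ?_⟩⟩
  · obtain ⟨rfl, hb⟩ := HalfSpaceStability.bisector_of_stationary hv hnc hst.1
    refine ⟨?_, rfl, hb⟩
    obtain ⟨i, m, h⟩ := HalfSpaceStability.exists_isBisectorAt hb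
    by_contra hN
    -- The index `m` already gives N ≥ 1, so N + 1 ≠ 2 leaves a coordinate other than `m` along
    -- which to destabilize.
    have : Nontrivial (Fin N) := by
      rw [Fin.nontrivial_iff_two_le]
      have := m.pos
      omega
    obtain ⟨k, hk⟩ := exists_ne m
    exact HalfSpaceStability.not_isStable_of_isBisectorAt hv h hk hst
  · rintro ⟨hN, rfl, hb⟩
    obtain rfl : N = 1 := by omega
    exact HalfSpaceStability.isStable_of_bisector hb
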